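/- Let $T=(T_1,\dots,T_n)$ be a commuting row contraction on a complex Hilbert space $\mathcal H$: the $T_i$ commute and the row operator $T:\mathcal H^n\to\mathcal H$, $T(h_1,\dots,h_n)=\sum_i T_ih_i$, is a contraction. Put $D_T=(I-T^*T)^{1/2}\in\mathcal B(\mathcal H^n)$, $D_{T^*}=(I-TT^*)^{1/2}\in\mathcal B(\mathcal H)$, $\mathcal D_T=\overline{\operatorname{ran}}\,D_T$, $\mathcal D_{T^*}=\overline{\operatorname{ran}}\,D_{T^*}$, and let $$\theta_T(z)=\bigl(-T+D_{T^*}(I-ZT^*)^{-1}ZD_T\bigr)\big|_{\mathcal D_T}\in\mathcal B(\mathcal D_T,\mathcal D_{T^*}),\qquad Z=(z_1I,\dots,z_nI),\quad z\in\mathbb B^n,$$ be its characteristic function. Suppose that $\theta_T$ is a polynomial of degree $m$, that is, its Taylor coefficients $\theta_{T,\beta}$ vanish for all $|\beta|>m$ and, unless $m=0$, $\theta_{T,\alpha}\ne 0$ for some $|\alpha|=m$ (the zero polynomial has degree $0$). Let $$\mathcal M=\overline{\operatorname{span}}\{T^\alpha D_{T^*}h:h\in\mathcal H,\ |\alpha|\ge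 m\},\quad \mathcal K=\overline{\operatorname{span}}\{T^\alpha D_{T^*}h:h\in\mathcal H,\ \alpha\in\mathbb Z_+^n\},\quad \mathcal H_{\rm nil}=\mathcal K\ominus\mathcal M,$$ let $M_i=T_i|_{\mathcal M}$, and let $N=(N_1,\dots,N_n)$, $N_i=P_{\mathcal H_{\rm nil}}T_i|_{\mathcal H_{\rm nil}}$, be the nilpotent part of $T$. Suppose that $T$ is regular, that is, there is $\epsilon>0$ such that for every $z\in\mathbb C^n$ with $\|z\|<\epsilon$ the space $\sum_i(M_i-z_iI)\mathcal M$ is closed and $\mathcal M$ is the algebraic direct sum of $\sum_i(M_i-z_iI)\mathcal M$ and $\mathcal M\ominus\sum_iM_i\mathcal M$. Let $H^2_n$ be the Drury--Arveson space, and for a Hilbert space $\mathcal F$ identify $H^2_n\otimes\mathcal F$ with the space of $\mathcal F$-valued power series $f=\sum_\alpha a_\alpha z^\alpha$ with $\|f\|^2=\sum_\alpha \frac{\alpha!}{|\alpha|!}\|a_\alpha\|^2<\infty$. Then $\theta_T$ and $\theta_N$ are multipliers, and there exist a Hilbert space $\mathcal E$, a co-isometry $G_1\in\mathcal B(H^2_n\otimes(\mathcal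 D_{N^*}\oplus\mathcal E),\,H^2_n\otimes\mathcal D_{T^*})$ and a partial isometry $G_2\in\mathcal B(H^2_n\otimes\mathcal D_T,\,H^2_n\otimes(\mathcal D_N\oplus\mathcal E))$, both of the form $G_j=I_{H^2_n}\otimes g_j$ with bounded operators $g_j$, such that, with $\theta_T$ and $\theta_N$ identified with their multiplication operators, $$\theta_T=G_1\begin{bmatrix}\theta_N&0\\0&I_{H^2_n\otimes\mathcal E}\end{bmatrix}G_2 .$$ -/

import Mathlib

universe u

noncomputable section

namespace CommutingRow

/-! ### Multi-indices -/

section MultiIndex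

variable {n : ℕ} {H : Type u} [NormedAddCommGroup H] [InnerProductSpace ℂ H]

/-- The length `|α| = α₁ + ⋯ + αₙ` of a multi-index. -/
def len (α : Fin n → ℕ) : ℕ := ∑ i, α i

/-- The multinomial coefficient `γ_α = |α|! / (α₁! ⋯ αₙ!)`. -/
def gam (α : Fin n → ℕ) : ℕ := Nat.multinomial Finset.univ α

/-- `γ_{α - e_j}`, with the convention that it is `0` if `α_j = 0`. -/
def gamPred (α : Fin n → ℕ) (j : Fin n) : ℕ :=
  if α j = 0 then 0 else gam (α - Pi.single j 1)

/-- The monomial `T^α = T₁^{α₁} ⋯ Tₙ^{αₙ}`. -/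
def monomial (T : Fin n → H →L[ℂ] H) (α : Fin n → ℕ) : H →L[ℂ] H :=
  (List.ofFn fun i => T i ^ α i).prod

theorem mul_monomial (T : Fin n → H →L[ℂ] H) (hT : ∀ i j, T i * T j = T j * T i)
    (i : Fin n) (α : Fin n → ℕ) : T i * monomial T α = monomial T (α + Pi.single i 1) := by
  unfold monomial
  induction n with
  | zero => exact i.elim0
  | succ n ih =>
    rw [List.ofFn_succ, List.ofFn_succ, List.prod_cons, List.prod_cons]
    refine Fin.cases ?_ (fun j => ?_) i
    · have h (k : Fin n) : (Pi.single (M := fun _ : Fin (n + 1) => ℕ) 0 1) k.succ = 0 :=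
        Pi.single_eq_of_ne (Fin.succ_ne_zero k) 1
      simp only [Pi.add_apply, Pi.single_eq_same, h, add_zero, pow_succ', mul_assoc]
    · have h0 : (Pi.single (M := fun _ : Fin (n + 1) => ℕ) j.succ 1) 0 = 0 :=
        Pi.single_eq_of_ne (Fin.succ_ne_zero j).symm 1
      have h (k : Fin n) : (Pi.single (M := fun _ : Fin (n + 1) => ℕ) j.succ 1) k.succ =
          (Pi.single (M := fun _ : Fin n => ℕ) j 1) k := by
        by_cases hk : k = j
        · subst hk; simp
        · rw [Pi.single_eq_of_ne (by simpa using hk), Pi.single_eq_of_ne hk]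
      have hc : T j.succ * T 0 ^ α 0 = T 0 ^ α 0 * T j.succ :=
        (show Commute (T j.succ) (T 0) from hT _ _).pow_right _
      have := ih (fun k => T k.succ) (fun a b => hT _ _) j (fun k => α k.succ)
      simp only [Pi.add_apply, h0, h, add_zero]
      rw [← mul_assoc, hc, mul_assoc, this]
      rfl

end MultiIndex

/-! ### The Drury-Arveson space -/

section DruryArveson

variable (n : ℕ) {E F G : Type*}
  [NormedAddCommGroup E] [InnerProductSpace ℂ E]
  [NormedAddCommGroup F] [InnerProductSpace ℂ F]
  [NormedAddCommGroup G] [InnerProductSpace ℂ G]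

/-- The vector-valued Drury-Arveson space `H²ₙ(E) = H²ₙ ⊗ E`: the power series `∑ a_α z^α` with
coefficients in `E` and `‖f‖² = ∑ ‖a_α‖² / γ_α < ∞`.  The element with Taylor coefficients `a_α` is
represented by the square-summable family of its normalised coefficients `a_α / √γ_α`, i.e. by its
coordinates with respect to the orthonormal family `√γ_α z^α`; see `coeff` and `norm_sq_eq`. -/
def DruryArveson (E : Type*) [NormedAddCommGroup E] : Type _ :=
  lp (fun _ : Fin n → ℕ => E) 2

instance : NormedAddCommGroup (DruryArveson n E) :=
  inferInstanceAs (NormedAddCommGroup (lp (fun _ : Fin n → ℕ => E) 2))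

instance : InnerProductSpace ℂ (DruryArveson n E) :=
  inferInstanceAs (InnerProductSpace ℂ (lp (fun _ : Fin n → ℕ => E) 2))

instance [CompleteSpace E] : CompleteSpace (DruryArveson n E) :=
  inferInstanceAs (CompleteSpace (lp (fun _ : Fin n → ℕ => E) 2))

variable {n}

/-- The coordinate `a_α / √γ_α` of `f`. -/
def coord (f : DruryArveson n E) (α : Fin n → ℕ) : E :=
  (show lp (fun _ : Fin n → ℕ => E) 2 from f) α

/-- The Taylor coefficient `a_α` of `f = ∑ a_α z^α`. -/
def coeff (f : DruryArveson n E) (α : Fin n → ℕ) : E :=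
  ((Real.sqrt (gam α) : ℝ) : ℂ) • coord f α

theorem gam_pos (α : Fin n → ℕ) : 0 < gam α := Nat.multinomial_pos _ _

theorem norm_sq_eq (f : DruryArveson n E) :
    ‖f‖ ^ 2 = ∑' α, ‖coeff f α‖ ^ 2 / (gam α : ℝ) := by
  have h := lp.norm_rpow_eq_tsum (p := 2) (by norm_num) f
  simp only [ENNReal.toReal_ofNat, Real.rpow_ofNat] at h
  refine Eq.trans h ?_
  congr 1
  ext α
  have hg : (0 : ℝ) < gam α := by exact_mod_cast gam_pos α
  rw [coeff, coord, norm_smul, Complex.norm_real, Real.norm_eq_abs, mul_pow, sq_abs,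
    Real.sq_sqrt hg.le]
  field_simp

/-- Every coefficient family with `∑ ‖a_α‖² / γ_α < ∞` occurs. -/
theorem exists_coeff_eq (a : (Fin n → ℕ) → E)
    (ha : Summable fun α => ‖a α‖ ^ 2 / (gam α : ℝ)) :
    ∃ f : DruryArveson n E, ∀ α, coeff f α = a α := by
  have hg (α : Fin n → ℕ) : (0 : ℝ) < gam α := by exact_mod_cast gam_pos α
  have hs (α : Fin n → ℕ) : ((Real.sqrt (gam α) : ℝ) : ℂ) ≠ 0 := by
    exact_mod_cast (Real.sqrt_pos.2 (hg α)).ne'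
  refine ⟨⟨fun α => ((Real.sqrt (gam α) : ℝ) : ℂ)⁻¹ • a α, ?_⟩, fun α => ?_⟩
  · refine memℓp_gen ?_
    simp only [ENNReal.toReal_ofNat, Real.rpow_ofNat]
    refine ha.congr fun α => ?_
    rw [norm_smul, norm_inv, Complex.norm_real, Real.norm_eq_abs, mul_pow, inv_pow, sq_abs,
      Real.sq_sqrt (hg α).le]
    field_simp
  · exact smul_inv_smul₀ (hs α) (a α)

/-- The value `f(z) = ∑ a_α z^α` (the series converges absolutely for `z` in the open unit ball). -/
def eval (f : DruryArveson n E) (z : EuclideanSpace ℂ (Fin n)) : E :=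
  ∑' α : Fin n → ℕ, (∏ i, z i ^ α i) • coeff f α

/-- `A` is the operator `M_φ` of multiplication by `φ`, i.e. `(A f)(z) = φ(z) f(z)` on the open
unit ball; in particular `φ` is a multiplier. -/
def IsMultiplicationBy (φ : EuclideanSpace ℂ (Fin n) → E →L[ℂ] F)
    (A : DruryArveson n E →L[ℂ] DruryArveson n F) : Prop :=
  ∀ f : DruryArveson n E, ∀ z ∈ Metric.ball (0 : EuclideanSpace ℂ (Fin n)) 1,
    eval (A f) z = φ z (eval f z)

/-- The operator `I_{H²ₙ} ⊗ X`, i.e. `X` applied to every coefficient. -/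
def ampl (n : ℕ) (X : E →L[ℂ] F) : DruryArveson n E →L[ℂ] DruryArveson n F :=
  lp.mapCLM 2 (fun _ : Fin n → ℕ => X) (K := ‖X‖) (norm_nonneg X) (fun _ => le_rfl)

theorem coeff_ampl (X : E →L[ℂ] F) (f : DruryArveson n E) (α : Fin n → ℕ) :
    coeff (ampl n X f) α = X (coeff f α) := by
  rw [coeff, coeff, map_smul]
  rfl

/-- The embedding `E → E ⊕ F` onto the first summand of the Hilbert direct sum. -/
def inl (E F : Type*) [NormedAddCommGroup E] [InnerProductSpace ℂ E]
    [NormedAddCommGroup F] [InnerProductSpace ℂ F] : E →L[ℂ] WithLp 2 (E × F) :=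
  (WithLp.prodContinuousLinearEquiv 2 ℂ E F).symm.toContinuousLinearMap ∘L
    ContinuousLinearMap.inl ℂ E F

/-- The embedding `F → E ⊕ F` onto the second summand of the Hilbert direct sum. -/
def inr (E F : Type*) [NormedAddCommGroup E] [InnerProductSpace ℂ E]
    [NormedAddCommGroup F] [InnerProductSpace ℂ F] : F →L[ℂ] WithLp 2 (E × F) :=
  (WithLp.prodContinuousLinearEquiv 2 ℂ E F).symm.toContinuousLinearMap ∘L
    ContinuousLinearMap.inr ℂ E F

/-- The block operator `diag(A, I_{H²ₙ ⊗ G})` from `H²ₙ ⊗ (E ⊕ G) = (H²ₙ ⊗ E) ⊕ (H²ₙ ⊗ G)` to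
`H²ₙ ⊗ (F ⊕ G) = (H²ₙ ⊗ F) ⊕ (H²ₙ ⊗ G)`. -/
def diagId (G : Type*) [NormedAddCommGroup G] [InnerProductSpace ℂ G]
    (A : DruryArveson n E →L[ℂ] DruryArveson n F) :
    DruryArveson n (WithLp 2 (E × G)) →L[ℂ] DruryArveson n (WithLp 2 (F × G)) :=
  ampl n (inl F G) ∘L A ∘L ampl n (WithLp.fstL 2 ℂ E G) +
    ampl n (inr F G) ∘L ampl n (WithLp.sndL 2 ℂ E G)

end DruryArveson

/-! ### Co-isometries and partial isometries -/

section Isometries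

variable {X Y : Type*} [NormedAddCommGroup X] [InnerProductSpace ℂ X] [CompleteSpace X]
  [NormedAddCommGroup Y] [InnerProductSpace ℂ Y] [CompleteSpace Y]

/-- `V` is a co-isometry: `V V* = I`. -/
def IsCoisometry (V : X →L[ℂ] Y) : Prop :=
  V ∘L ContinuousLinearMap.adjoint V = ContinuousLinearMap.id ℂ Y

/-- `V` is a partial isometry: `V V* V = V`. -/
def IsPartialIsometry (V : X →L[ℂ] Y) : Prop :=
  V ∘L ContinuousLinearMap.adjoint V ∘L V = V

end Isometries

/-! ### Row operators, defect operators, characteristic functions -/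

section Row

variable {n : ℕ} {H : Type u} [NormedAddCommGroup H] [InnerProductSpace ℂ H]

/-- The row operator `Hⁿ → H`, `(h₁, …, hₙ) ↦ ∑ Tᵢ hᵢ`, on the Hilbert space direct sum `Hⁿ`. -/
def row (T : Fin n → H →L[ℂ] H) : PiLp 2 (fun _ : Fin n => H) →L[ℂ] H :=
  ∑ i, T i ∘L PiLp.proj 2 (fun _ : Fin n => H) i

variable [CompleteSpace H]

/-- Commuting row contraction: the `Tᵢ` commute and the row operator is a contraction. -/
structure IsCommutingRowContraction (T : Fin n → H →L[ℂ] H) : Prop where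
  comm : ∀ i j, T i * T j = T j * T i
  contr : ‖row T‖ ≤ 1

/-- The defect operator `D_T = (I - T*T)^{1/2}` on `Hⁿ`. -/
def defect (T : Fin n → H →L[ℂ] H) :
    PiLp 2 (fun _ : Fin n => H) →L[ℂ] PiLp 2 (fun _ : Fin n => H) :=
  CFC.sqrt (1 - ContinuousLinearMap.adjoint (row T) ∘L row T)

/-- The defect operator `D_{T*} = (I - TT*)^{1/2}` on `H`. -/
def defectStar (T : Fin n → H →L[ℂ] H) : H →L[ℂ] H :=
  CFC.sqrt (1 - row T ∘L ContinuousLinearMap.adjoint (row T))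

/-- The defect space `𝓓_T`, the closure of the range of `D_T`. -/
def defectSpace (T : Fin n → H →L[ℂ] H) : Submodule ℂ (PiLp 2 (fun _ : Fin n => H)) :=
  (defect T).range.topologicalClosure

instance (T : Fin n → H →L[ℂ] H) : CompleteSpace (defectSpace T) :=
  (Submodule.isClosed_topologicalClosure _).completeSpace_coe

/-- The defect space `𝓓_{T*}`, the closure of the range of `D_{T*}`. -/
def defectStarSpace (T : Fin n → H →L[ℂ] H) : Submodule ℂ H :=
  (defectStar T).range.topologicalClosure

instance (T : Fin n → H →L[ℂ] H) : CompleteSpace (defectStarSpace T) :=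
  (Submodule.isClosed_topologicalClosure _).completeSpace_coe

/-- An operator `A : Hⁿ → H` restricted to `𝓓_T` and regarded as an operator `𝓓_T → 𝓓_{T*}`.
The projection onto `𝓓_{T*}` only adjusts the codomain: the operators below map `𝓓_T` into
`𝓓_{T*}`, because `T D_T = D_{T*} T`. -/
def restrictDefect (T : Fin n → H →L[ℂ] H) (A : PiLp 2 (fun _ : Fin n => H) →L[ℂ] H) :
    defectSpace T →L[ℂ] defectStarSpace T :=
  (defectStarSpace T).orthogonalProjectionOnto ∘L A ∘L (defectSpace T).subtypeL

/-- The characteristic function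
`θ_T(z) = (-T + D_{T*} (I - Z T*)⁻¹ Z D_T)|_{𝓓_T}`, where `Z = (z₁ I, …, zₙ I)`.  For a row
contraction `T` and `z` in the open unit ball, `I - Z T* = I - ∑ zᵢ Tᵢ*` is invertible. -/
def charFun (T : Fin n → H →L[ℂ] H) (z : EuclideanSpace ℂ (Fin n)) :
    defectSpace T →L[ℂ] defectStarSpace T :=
  restrictDefect T
    (-row T + defectStar T ∘L
      Ring.inverse (1 - row (fun i => z i • (1 : H →L[ℂ] H)) ∘L
        ContinuousLinearMap.adjoint (row T)) ∘L
      row (fun i => z i • (1 : H →L[ℂ] H)) ∘L defect T)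

/-- The Taylor coefficient `θ_{T,α}` of `z^α` in `θ_T`: `-T|_{𝓓_T}` if `α = 0`, and
`∑_j γ_{α-e_j} D_{T*} T^{*(α-e_j)} P_j D_T|_{𝓓_T}` otherwise. -/
def charCoeff (T : Fin n → H →L[ℂ] H) (α : Fin n → ℕ) :
    defectSpace T →L[ℂ] defectStarSpace T :=
  restrictDefect T
    (if α = 0 then -row T else
      ∑ j, (gamPred α j : ℂ) • (defectStar T ∘L
        monomial (fun i => ContinuousLinearMap.adjoint (T i)) (α - Pi.single j 1) ∘L
        PiLp.proj 2 (fun _ : Fin n => H) j ∘L defect T))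

/-- `θ_T` is a polynomial of degree `m`; constant functions, including zero, have degree `0`. -/
def CharFunIsPolynomialOfDegree (T : Fin n → H →L[ℂ] H) (m : ℕ) : Prop :=
  (∀ β, m < len β → charCoeff T β = 0) ∧ (m = 0 ∨ ∃ α, len α = m ∧ charCoeff T α ≠ 0)

/-! ### The canonical representation and regularity -/

/-- `span {T^α D_{T*} h : h ∈ H, |α| ≥ m}`, closed. -/
def shiftSpace (T : Fin n → H →L[ℂ] H) (m : ℕ) : Submodule ℂ H :=
  (Submodule.span ℂ
    {x | ∃ (α : Fin n → ℕ) (h : H), m ≤ len α ∧ x = monomial T α (defectStar T h)}).topologicalClosure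

instance (T : Fin n → H →L[ℂ] H) (m : ℕ) : CompleteSpace (shiftSpace T m) :=
  (Submodule.isClosed_topologicalClosure _).completeSpace_coe

/-- `H_nil = 𝒦 ⊖ 𝓜`, where `𝓜 = shiftSpace T m` and
`𝒦 = shiftSpace T 0` is the closed span of all `T^α D_{T*} h`. -/
def nilSpace (T : Fin n → H →L[ℂ] H) (m : ℕ) : Submodule ℂ H :=
  shiftSpace T 0 ⊓ (shiftSpace T m)ᗮ

theorem isClosed_nilSpace (T : Fin n → H →L[ℂ] H) (m : ℕ) :
    IsClosed (nilSpace T m : Set H) := by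
  rw [nilSpace, Submodule.coe_inf]
  exact (Submodule.isClosed_topologicalClosure _).inter (Submodule.isClosed_orthogonal _)

instance (T : Fin n → H →L[ℂ] H) (m : ℕ) : CompleteSpace (nilSpace T m) :=
  (isClosed_nilSpace T m).completeSpace_coe

/-- The compression `P_S A|_S` of `A` to a subspace `S`; if `A S ⊆ S` it is the restriction. -/
def compression (S : Submodule ℂ H) [S.HasOrthogonalProjection] (A : H →L[ℂ] H) : S →L[ℂ] S :=
  S.orthogonalProjectionOnto ∘L A ∘L S.subtypeL

/-- The tuple `M = T|_𝓜` on `𝓜` (the space `𝓜` is invariant under a commuting tuple `T`, see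
`shiftPart_apply`). -/
def shiftPart (T : Fin n → H →L[ℂ] H) (m : ℕ) (i : Fin n) :
    shiftSpace T m →L[ℂ] shiftSpace T m :=
  compression (shiftSpace T m) (T i)

/-- The nilpotent part `N = P_{H_nil} T|_{H_nil}` of the canonical representation of `T`. -/
def nilPart (T : Fin n → H →L[ℂ] H) (m : ℕ) (i : Fin n) : nilSpace T m →L[ℂ] nilSpace T m :=
  compression (nilSpace T m) (T i)

/-- `𝓜` is invariant under a commuting tuple `T`. -/
theorem apply_mem_shiftSpace (T : Fin n → H →L[ℂ] H) (hT : ∀ i j, T i * T j = T j * T i)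
    (m : ℕ) (i : Fin n) {x : H} (hx : x ∈ shiftSpace T m) : T i x ∈ shiftSpace T m := by
  have hmap : Set.MapsTo (T i)
      (Submodule.span ℂ {x | ∃ (α : Fin n → ℕ) (h : H), m ≤ len α ∧
        x = monomial T α (defectStar T h)} : Set H)
      (Submodule.span ℂ {x | ∃ (α : Fin n → ℕ) (h : H), m ≤ len α ∧
        x = monomial T α (defectStar T h)} : Set H) := by
    intro y hy
    refine Submodule.span_induction (p := fun y _ => T i y ∈ Submodule.span ℂ _)
      ?_ ?_ ?_ ?_ hy
    · rintro _ ⟨α, h, hα, rfl⟩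
      refine Submodule.subset_span ⟨α + Pi.single i 1, h, ?_, ?_⟩
      · exact hα.trans (Finset.sum_le_sum fun j _ => Nat.le_add_right _ _)
      · rw [← mul_monomial T hT i α]; rfl
    · simp
    · intro a b _ _ ha hb; rw [map_add]; exact add_mem ha hb
    · intro c a _ ha; rw [map_smul]; exact Submodule.smul_mem _ c ha
  exact map_mem_closure (T i).continuous hx hmap

/-- On `𝓜` the tuple `M` acts as `T`. -/
theorem shiftPart_apply (T : Fin n → H →L[ℂ] H) (hT : ∀ i j, T i * T j = T j * T i)
    (m : ℕ) (i : Fin n) (x : shiftSpace T m) : (shiftPart T m i x : H) = T i x := by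
  have := Submodule.starProjection_eq_self_iff.2 (apply_mem_shiftSpace T hT m i x.2)
  exact this

/-- A commuting tuple `A` on `X` is regular if for some `ε > 0` and all `‖z‖ < ε` the space
`(A - Z) Xⁿ` is closed and `X` is the algebraic direct sum of `(A - Z) Xⁿ` and
`X ⊖ ∑ Aᵢ X`. -/
def IsRegularTuple {X : Type*} [NormedAddCommGroup X] [InnerProductSpace ℂ X]
    (A : Fin n → X →L[ℂ] X) : Prop :=
  ∃ ε : ℝ, 0 < ε ∧ ∀ z : EuclideanSpace ℂ (Fin n), ‖z‖ < ε →
    IsClosed ((row fun i => A i - z i • (1 : X →L[ℂ] X)).range : Set X) ∧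
    IsCompl (row fun i => A i - z i • (1 : X →L[ℂ] X)).range ((row A).range)ᗮ

end Row

end CommutingRow

end

open CommutingRow

noncomputable section

namespace CommutingRow

open ContinuousLinearMap

/-! ### Contractions between Hilbert spaces and their defect operators -/

section Contraction

variable {X Y Z : Type*} [NormedAddCommGroup X] [InnerProductSpace ℂ X] [CompleteSpace X]
  [NormedAddCommGroup Y] [InnerProductSpace ℂ Y] [CompleteSpace Y]
  [NormedAddCommGroup Z] [InnerProductSpace ℂ Z] [CompleteSpace Z]

/-! Read `θ_T` as a transfer function: `θ_T(z) x = D_{T*} h - T x`, where the state `h` solves `h =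
Z (T* h + D_T x)` (`charFun_apply`). Split `H = 𝓜 ⊕ H_nil ⊕ 𝒦ᗮ`. Only the `H_nil` component of the
state matters (`charFun_apply_eq_nilSpace`).

The `𝒦ᗮ` component is killed by `D_{T*}` and is not fed into `H_nil`, since `T_i*` preserves `𝒦ᗮ`.
For the `𝓜` component `g`, vanishing of the coefficients beyond degree `m` makes the row `A` of
`T|_𝓜` a partial isometry (`row_shiftPart_partialIsometry`). Then `g - AA*g` lies both in `ran (A -
Z)` and in `(ran A)ᗮ`, so regularity gives `AA*g = g` for small `z`, and the identity theorem gives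
it on the whole ball (`IsRegularTuple.row_adjoint_row_eq`). Hence `T* g` stays in `𝓜ⁿ` and `D_{T*} g
= 0`.

The surviving state solves the state equation of `N` with input `P D_T x`, which equals `D_N R x`
for a contraction `R : 𝓓_T → 𝓓_N` (`exists_defect_compression`). An energy balance
(`norm_sq_output_le`) and Douglas' lemma then give a contraction `Γ` with `θ_T(z) x = Γ (θ_N(z) R x
⊕ D_R x)`. Dilating `Γ` to a co-isometry and replacing `R` by the isometry `x ↦ R x ⊕ D_R x ⊕ 0`
yields constant operators `g₁`, `g₂` with the factorization at every `z`
(`exists_coisometry_isometry`).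

On the function space, `N` is nilpotent, so `θ_N` is a polynomial built from coordinate
multiplications and is a multiplier. The multiplier `θ_T` is then obtained as the product itself. -/

/-- The defect operator `(I - A*A)^{1/2}` of `A`. -/
def defectOp (A : X →L[ℂ] Y) : X →L[ℂ] X := CFC.sqrt (1 - adjoint A ∘L A)

theorem one_sub_adjoint_comp_self_nonneg {A : X →L[ℂ] Y} (hA : ‖A‖ ≤ 1) :
    0 ≤ 1 - adjoint A ∘L A := by
  rw [ContinuousLinearMap.nonneg_iff_isPositive, ContinuousLinearMap.isPositive_def']
  refine ⟨?_, fun x => ?_⟩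
  · rw [ContinuousLinearMap.isSelfAdjoint_iff']
    rw [map_sub, adjoint_comp, adjoint_adjoint]
    congr 1
    exact (IsSelfAdjoint.one (X →L[ℂ] X))
  · rw [reApplyInnerSelf_apply, sub_apply, inner_sub_left, comp_apply, adjoint_inner_left,
      one_apply_eq_self, map_sub, inner_self_eq_norm_sq, inner_self_eq_norm_sq, sub_nonneg]
    have := (A.le_of_opNorm_le hA x)
    rw [one_mul] at this
    gcongr

theorem defectOp_comp_self {A : X →L[ℂ] Y} (hA : ‖A‖ ≤ 1) (x : X) :
    defectOp A (defectOp A x) = x - adjoint A (A x) :=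
  DFunLike.congr_fun (CFC.sqrt_mul_sqrt_self _ (one_sub_adjoint_comp_self_nonneg hA)) x

theorem isSelfAdjoint_defectOp (A : X →L[ℂ] Y) : IsSelfAdjoint (defectOp A) :=
  IsSelfAdjoint.of_nonneg (CFC.sqrt_nonneg _)

theorem inner_defectOp_left (A : X →L[ℂ] Y) (x y : X) :
    inner ℂ (defectOp A x) y = inner ℂ x (defectOp A y) := by
  conv_rhs => rw [← (isSelfAdjoint_defectOp A).adjoint_eq]
  rw [adjoint_inner_right]

theorem norm_defectOp_sq {A : X →L[ℂ] Y} (hA : ‖A‖ ≤ 1) (x : X) :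
    ‖defectOp A x‖ ^ 2 = ‖x‖ ^ 2 - ‖A x‖ ^ 2 := by
  have h : (inner ℂ (defectOp A x) (defectOp A x) : ℂ) = inner ℂ x x - inner ℂ (A x) (A x) := by
    rw [inner_defectOp_left, defectOp_comp_self hA, inner_sub_right, adjoint_inner_right]
  simp only [inner_self_eq_norm_sq_to_K] at h
  exact_mod_cast h

theorem defectOp_eq_zero_iff {A : X →L[ℂ] Y} (hA : ‖A‖ ≤ 1) (x : X) :
    defectOp A x = 0 ↔ adjoint A (A x) = x := by
  constructor
  · intro h
    have := defectOp_comp_self hA x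
    rw [h, map_zero] at this
    exact (sub_eq_zero.1 this.symm).symm
  · intro h
    have := norm_defectOp_sq hA x
    have h2 : (inner ℂ (A x) (A x) : ℂ) = inner ℂ x x := by
      rw [← adjoint_inner_right, h]
    simp only [inner_self_eq_norm_sq_to_K] at h2
    have h3 : ‖A x‖ ^ 2 = ‖x‖ ^ 2 := by exact_mod_cast h2
    rw [h3, sub_self] at this
    simpa using this

set_option synthInstance.maxHeartbeats 200000 in
/-- The intertwining relation `A D_A = D_{A*} A`. -/
theorem apply_defectOp {A : X →L[ℂ] Y} (hA : ‖A‖ ≤ 1) (x : X) :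
    A (defectOp A x) = defectOp (adjoint A) (A x) := by
  have hA' : ‖adjoint A‖ ≤ 1 := by rwa [LinearIsometryEquiv.norm_map]
  let D := defectOp A
  let B := defectOp (adjoint A)
  -- An intertwining relation between two spaces becomes a commutation on `X ⊕ Y`: `S`, with `A` as
  -- its only nonzero corner, commutes with `Q² = diag(I - A*A, I - AA*)`, hence with its positive
  -- square root `Q = diag(D_A, D_{A*})`.
  let Q : WithLp 2 (X × Y) →L[ℂ] WithLp 2 (X × Y) :=
    inl X Y ∘L D ∘L WithLp.fstL 2 ℂ X Y + inr X Y ∘L B ∘L WithLp.sndL 2 ℂ X Y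
  let S : WithLp 2 (X × Y) →L[ℂ] WithLp 2 (X × Y) := inr X Y ∘L A ∘L WithLp.fstL 2 ℂ X Y
  have hQ (p : WithLp 2 (X × Y)) : Q p = WithLp.toLp 2 (D p.fst, B p.snd) := by
    apply (WithLp.equiv 2 (X × Y)).injective
    simp [Q, inl, inr]
  have hS (p : WithLp 2 (X × Y)) : S p = WithLp.toLp 2 (0, A p.fst) := by
    simp [S, inr]
  have hQ' (a : X) (b : Y) : Q (WithLp.toLp 2 (a, b)) = WithLp.toLp 2 (D a, B b) := hQ _
  have hS' (a : X) (b : Y) : S (WithLp.toLp 2 (a, b)) = WithLp.toLp 2 (0, A a) := hS _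
  have hQpos : 0 ≤ Q := by
    rw [ContinuousLinearMap.nonneg_iff_isPositive, ContinuousLinearMap.isPositive_def]
    have hD : D.IsPositive := (ContinuousLinearMap.nonneg_iff_isPositive _).1 (CFC.sqrt_nonneg _)
    have hB : B.IsPositive := (ContinuousLinearMap.nonneg_iff_isPositive _).1 (CFC.sqrt_nonneg _)
    refine ⟨fun p q => ?_, fun p => ?_⟩
    · simp only [coe_coe, hQ, WithLp.prod_inner_apply, D, B]
      exact congrArg₂ _ (inner_defectOp_left _ _ _) (inner_defectOp_left _ _ _)
    · rw [reApplyInnerSelf_apply, hQ, WithLp.prod_inner_apply, map_add]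
      exact add_nonneg (hD.re_inner_nonneg_left _) (hB.re_inner_nonneg_left _)
  have hcomm : Commute (Q * Q) S := by
    refine ContinuousLinearMap.ext fun p => ?_
    change Q (Q (S p)) = S (Q (Q p))
    rw [hS p, hQ', hQ', hQ p, hQ', hS', map_zero, map_zero, defectOp_comp_self hA,
      defectOp_comp_self hA', map_sub, adjoint_adjoint]
  have hsq : CFC.sqrt (Q * Q) = Q := CFC.sqrt_unique rfl hQpos
  have hc : Commute (CFC.sqrt (Q * Q)) S := by
    unfold CFC.sqrt
    exact hcomm.cfcₙ_nnreal _
  rw [hsq] at hc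
  have h := congrArg WithLp.snd (DFunLike.congr_fun hc.eq (WithLp.toLp 2 (x, 0)))
  change (Q (S (WithLp.toLp 2 (x, 0)))).snd = (S (Q (WithLp.toLp 2 (x, 0)))).snd at h
  rw [hQ', hS', hS', hQ'] at h
  exact h.symm

/-- The operator `(h, x) ↦ (A* h + D_A x, D_{A*} h - A x)` is norm preserving. -/
theorem norm_sq_add_norm_sq_colligation {A : X →L[ℂ] Y} (hA : ‖A‖ ≤ 1) (h : Y) (x : X) :
    ‖adjoint A h + defectOp A x‖ ^ 2 + ‖defectOp (adjoint A) h - A x‖ ^ 2 =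
      ‖h‖ ^ 2 + ‖x‖ ^ 2 := by
  have hA' : ‖adjoint A‖ ≤ 1 := by rwa [LinearIsometryEquiv.norm_map]
  rw [norm_add_sq (𝕜 := ℂ), norm_sub_sq (𝕜 := ℂ), norm_defectOp_sq hA, norm_defectOp_sq hA',
    adjoint_inner_left, apply_defectOp hA, inner_defectOp_left]
  ring

omit [CompleteSpace X] in
/-- **Douglas' lemma**. -/
theorem exists_comp_eq_of_norm_le (A : X →L[ℂ] Y) (B : X →L[ℂ] Z) (h : ∀ x, ‖A x‖ ≤ ‖B x‖) :
    ∃ K : Z →L[ℂ] Y, ‖K‖ ≤ 1 ∧ ∀ x, K (B x) = A x := by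
  let R : Submodule ℂ Z := B.range.topologicalClosure
  have : CompleteSpace R := (Submodule.isClosed_topologicalClosure _).completeSpace_coe
  have hmem (x : X) : B x ∈ R := Submodule.le_topologicalClosure _ ⟨x, rfl⟩
  let e : X →ₗ[ℂ] R := LinearMap.codRestrict R B.toLinearMap hmem
  have hd : DenseRange e := by
    intro y
    rw [closure_subtype]
    have : (Subtype.val '' Set.range e) = (B.range : Set Z) := by
      ext z
      constructor
      · rintro ⟨_, ⟨x, rfl⟩, rfl⟩
        exact ⟨x, rfl⟩
      · rintro ⟨x, rfl⟩
        exact ⟨e x, ⟨x, rfl⟩, rfl⟩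
    rw [this]
    exact y.2
  have hn (x : X) : ‖A.toLinearMap x‖ ≤ 1 * ‖e x‖ := by
    rw [one_mul]
    exact h x
  -- `B x ↦ A x` is well defined and contractive on `ran B`; it is extended by continuity to the
  -- closure and by zero to the complement.
  refine ⟨A.toLinearMap.extendOfNorm e ∘L R.orthogonalProjectionOnto, ?_, fun x => ?_⟩
  · refine (opNorm_comp_le _ _).trans ?_
    exact mul_le_one₀ (LinearMap.opNorm_extendOfNorm_le hd zero_le_one hn) (norm_nonneg _)
      (Submodule.orthogonalProjectionOnto_norm_le _)
  · rw [comp_apply]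
    have : R.orthogonalProjectionOnto (B x) = e x :=
      Submodule.orthogonalProjectionOnto_mem_subspace_eq_self (⟨B x, hmem x⟩ : R)
    rw [this]
    exact LinearMap.extendOfNorm_eq hd ⟨1, hn⟩ x

end Contraction

/-! ### Row operators -/

section RowLemmas

variable {n : ℕ} {H E F : Type*} [NormedAddCommGroup H] [InnerProductSpace ℂ H]
  [NormedAddCommGroup E] [InnerProductSpace ℂ E] [NormedAddCommGroup F] [InnerProductSpace ℂ F]

/-- The operator `Eⁿ → Fⁿ` applying `V` to every entry. -/
def piMap (n : ℕ) (V : E →L[ℂ] F) :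
    PiLp 2 (fun _ : Fin n => E) →L[ℂ] PiLp 2 (fun _ : Fin n => F) :=
  (PiLp.continuousLinearEquiv 2 ℂ (fun _ : Fin n => F)).symm.toContinuousLinearMap ∘L
    ContinuousLinearMap.pi fun i => V ∘L PiLp.proj 2 (fun _ : Fin n => E) i

@[simp]
theorem piMap_apply (V : E →L[ℂ] F) (x : PiLp 2 (fun _ : Fin n => E)) (i : Fin n) :
    piMap n V x i = V (x i) := rfl

theorem row_apply (T : Fin n → H →L[ℂ] H) (x : PiLp 2 (fun _ : Fin n => H)) :
    row T x = ∑ i, T i (x i) := by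
  simp [row, sum_apply]

theorem norm_piMap_apply {V : E →L[ℂ] F} (hV : ∀ x, ‖V x‖ = ‖x‖)
    (x : PiLp 2 (fun _ : Fin n => E)) : ‖piMap n V x‖ = ‖x‖ := by
  rw [← sq_eq_sq₀ (norm_nonneg _) (norm_nonneg _), PiLp.norm_sq_eq_of_L2, PiLp.norm_sq_eq_of_L2]
  simp [hV]

theorem norm_piMap_le (V : E →L[ℂ] F) : ‖piMap n V‖ ≤ ‖V‖ := by
  refine opNorm_le_bound _ (norm_nonneg _) fun x => ?_
  refine le_of_sq_le_sq ?_ (by positivity)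
  rw [mul_pow, PiLp.norm_sq_eq_of_L2, PiLp.norm_sq_eq_of_L2, Finset.mul_sum]
  refine Finset.sum_le_sum fun i _ => ?_
  rw [← mul_pow]
  have := V.le_opNorm (x i)
  rw [piMap_apply]
  gcongr

variable [CompleteSpace H] [CompleteSpace E] [CompleteSpace F]

theorem adjoint_row_apply (T : Fin n → H →L[ℂ] H) (h : H) (i : Fin n) :
    adjoint (row T) h i = adjoint (T i) h := by
  classical
  refine ext_inner_right ℂ fun y => ?_
  have h1 : (inner ℂ (adjoint (row T) h) (PiLp.single 2 i y) : ℂ) = inner ℂ h (T i y) := by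
    rw [adjoint_inner_left, row_apply]
    congr 1
    rw [Finset.sum_eq_single i]
    · simp
    · intro j _ hj; simp [hj]
    · simp
  rw [PiLp.inner_apply, Finset.sum_eq_single i] at h1
  · rw [adjoint_inner_left, ← h1]
    simp
  · intro j _ hj; simp [hj]
  · simp

theorem adjoint_piMap (V : E →L[ℂ] F) : adjoint (piMap n V) = piMap n (adjoint V) := by
  symm
  rw [eq_adjoint_iff]
  intro x y
  rw [PiLp.inner_apply, PiLp.inner_apply]
  simp [adjoint_inner_left]

omit [CompleteSpace H] in
theorem norm_row_smul_one_le (z : EuclideanSpace ℂ (Fin n)) :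
    ‖row (fun i => z i • (1 : H →L[ℂ] H))‖ ≤ ‖z‖ := by
  refine opNorm_le_bound _ (norm_nonneg _) fun x => ?_
  rw [row_apply]
  refine (norm_sum_le _ _).trans ?_
  simp only [smul_apply, one_apply_eq_self, norm_smul]
  refine (Real.sum_mul_le_sqrt_mul_sqrt _ _ _).trans_eq ?_
  rw [EuclideanSpace.norm_eq, PiLp.norm_eq_of_L2]

theorem isUnit_one_sub_row_comp (T : Fin n → H →L[ℂ] H) (hT : ‖row T‖ ≤ 1)
    {z : EuclideanSpace ℂ (Fin n)} (hz : ‖z‖ < 1) :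
    IsUnit (1 - row (fun i => z i • (1 : H →L[ℂ] H)) ∘L adjoint (row T)) := by
  refine isUnit_one_sub_of_norm_lt_one ?_
  refine (opNorm_comp_le _ _).trans_lt ?_
  have h1 : ‖adjoint (row T)‖ ≤ 1 := by rwa [LinearIsometryEquiv.norm_map]
  have h2 := norm_row_smul_one_le (H := H) z
  calc _ ≤ ‖z‖ * 1 := by gcongr
    _ < 1 := by simpa

end RowLemmas

/-! ### Multipliers of the Drury-Arveson space -/

section Multipliers

variable {n : ℕ} {E F G : Type*}
  [NormedAddCommGroup E] [InnerProductSpace ℂ E]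
  [NormedAddCommGroup F] [InnerProductSpace ℂ F]
  [NormedAddCommGroup G] [InnerProductSpace ℂ G]

omit [InnerProductSpace ℂ E] in
theorem DruryArveson.ext_coord {f g : DruryArveson n E} (h : ∀ α, coord f α = coord g α) :
    f = g :=
  lp.ext (funext h)

omit [InnerProductSpace ℂ E] in
theorem coord_add (f g : DruryArveson n E) (α : Fin n → ℕ) :
    coord (f + g) α = coord f α + coord g α := rfl

omit [InnerProductSpace ℂ E] in
theorem summable_norm_coord_sq (f : DruryArveson n E) : Summable fun α => ‖coord f α‖ ^ 2 := by
  have := (lp.memℓp (show lp (fun _ : Fin n → ℕ => E) 2 from f)).summable (by norm_num)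
  simp only [ENNReal.toReal_ofNat, Real.rpow_ofNat] at this
  exact this

omit [InnerProductSpace ℂ E] in
theorem norm_sq_eq_tsum_coord (f : DruryArveson n E) : ‖f‖ ^ 2 = ∑' α, ‖coord f α‖ ^ 2 := by
  have h := lp.norm_rpow_eq_tsum (p := 2) (by norm_num) f
  simp only [ENNReal.toReal_ofNat, Real.rpow_ofNat] at h
  exact h

theorem ampl_comp (X : F →L[ℂ] G) (Y : E →L[ℂ] F) : ampl n (X ∘L Y) = ampl n X ∘L ampl n Y :=
  rfl

theorem ampl_id : ampl n (ContinuousLinearMap.id ℂ E) = ContinuousLinearMap.id ℂ _ := rfl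

theorem adjoint_ampl [CompleteSpace E] [CompleteSpace F] (X : E →L[ℂ] F) :
    adjoint (ampl n X) = ampl n (adjoint X) := by
  symm
  rw [eq_adjoint_iff]
  intro f g
  refine (lp.inner_eq_tsum (𝕜 := ℂ) _ _).trans (Eq.trans ?_ (lp.inner_eq_tsum (𝕜 := ℂ) _ _).symm)
  refine tsum_congr fun α => ?_
  exact adjoint_inner_left X _ _

theorem IsCoisometry.ampl [CompleteSpace E] [CompleteSpace F] {g : E →L[ℂ] F}
    (hg : IsCoisometry g) : IsCoisometry (CommutingRow.ampl n g) := by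
  rw [IsCoisometry, adjoint_ampl, ← ampl_comp, hg, ampl_id]

theorem isPartialIsometry_ampl [CompleteSpace E] [CompleteSpace F] {g : E →L[ℂ] F}
    (hg : ∀ x, ‖g x‖ = ‖x‖) : IsPartialIsometry (ampl n g) := by
  have h : adjoint g ∘L g = ContinuousLinearMap.id ℂ E := (norm_map_iff_adjoint_comp_self g).1 hg
  rw [IsPartialIsometry, adjoint_ampl, ← ampl_comp, h, ampl_id]
  rfl

/-- By the multinomial theorem the terms of degree `k` add up to `‖z‖^{2k}`, so the series is
dominated by a geometric one. Its sum is the Drury–Arveson kernel on the diagonal. -/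
theorem summable_gam_mul_prod {z : EuclideanSpace ℂ (Fin n)} (hz : ‖z‖ < 1) :
    Summable fun α : Fin n → ℕ => (gam α : ℝ) * ∏ i, (‖z i‖ ^ 2) ^ α i := by
  classical
  have hr : ‖z‖ ^ 2 < 1 := by
    rw [sq_lt_one_iff₀ (norm_nonneg z)]
    exact hz
  have hdeg (k : ℕ) : ∑ α ∈ Finset.piAntidiag Finset.univ k,
      (gam α : ℝ) * ∏ i, (‖z i‖ ^ 2) ^ α i = (‖z‖ ^ 2) ^ k := by
    rw [EuclideanSpace.norm_sq_eq, Finset.sum_pow_eq_sum_piAntidiag]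
    rfl
  refine summable_of_sum_le (c := (1 - ‖z‖ ^ 2)⁻¹) (fun α => by positivity) fun s => ?_
  let K := s.sup len + 1
  have hsub : s ⊆ (Finset.range K).biUnion fun k => Finset.piAntidiag Finset.univ k := by
    intro α hα
    rw [Finset.mem_biUnion]
    refine ⟨len α, ?_, ?_⟩
    · rw [Finset.mem_range]
      exact Nat.lt_succ_of_le (Finset.le_sup (f := len) hα)
    · simp [len]
  refine (Finset.sum_le_sum_of_subset_of_nonneg hsub fun α _ _ => by positivity).trans ?_
  rw [Finset.sum_biUnion]
  · simp_rw [hdeg]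
    rw [← tsum_geometric_of_lt_one (by positivity) hr]
    exact (summable_geometric_of_lt_one (by positivity) hr).sum_le_tsum _
      (fun k _ => by positivity)
  · intro k _ l _ hkl
    rw [Function.onFun, Finset.disjoint_left]
    intro α hk hl
    simp only [Finset.mem_piAntidiag] at hk hl
    exact hkl (hk.1.symm.trans hl.1)

theorem summable_eval [CompleteSpace E] (f : DruryArveson n E) {z : EuclideanSpace ℂ (Fin n)}
    (hz : ‖z‖ < 1) : Summable fun α : Fin n → ℕ => (∏ i, z i ^ α i) • coeff f α := by
  refine Summable.of_norm ?_
  refine Summable.of_nonneg_of_le (fun _ => norm_nonneg _) (fun α => ?_)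
    ((summable_gam_mul_prod hz).add (summable_norm_coord_sq f))
  have h : (gam α : ℝ) * ∏ i, (‖z i‖ ^ 2) ^ α i = (Real.sqrt (gam α) * ∏ i, ‖z i‖ ^ α i) ^ 2 := by
    rw [mul_pow, Real.sq_sqrt (Nat.cast_nonneg _), ← Finset.prod_pow]
    congr 1
    exact Finset.prod_congr rfl fun i _ => by rw [← pow_mul, ← pow_mul, mul_comm]
  rw [h, coeff, smul_smul, norm_smul, norm_mul, Complex.norm_real, Real.norm_of_nonneg
    (Real.sqrt_nonneg _), norm_prod]
  simp only [norm_pow]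
  -- The bound `ab ≤ a² + b²` with `a = √γ_α |z^α|` and `b` the norm of the normalised coefficient.
  nlinarith [sq_nonneg (Real.sqrt (gam α) * ∏ i, ‖z i‖ ^ α i - ‖coord f α‖),
    sq_nonneg (Real.sqrt (gam α) * ∏ i, ‖z i‖ ^ α i + ‖coord f α‖)]

theorem eval_add [CompleteSpace E] (f g : DruryArveson n E) {z : EuclideanSpace ℂ (Fin n)}
    (hz : ‖z‖ < 1) : eval (f + g) z = eval f z + eval g z := by
  rw [eval, eval, eval, ← (summable_eval f hz).tsum_add (summable_eval g hz)]
  refine tsum_congr fun α => ?_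
  rw [coeff, coord_add, smul_add, smul_add]
  rfl

theorem eval_ampl [CompleteSpace E] (X : E →L[ℂ] F) (f : DruryArveson n E)
    {z : EuclideanSpace ℂ (Fin n)} (hz : ‖z‖ < 1) : eval (ampl n X f) z = X (eval f z) := by
  rw [eval, eval, X.map_tsum (summable_eval f hz)]
  refine tsum_congr fun α => ?_
  rw [coeff_ampl, map_smul]

theorem isMultiplicationBy_ampl [CompleteSpace E] (X : E →L[ℂ] F) :
    IsMultiplicationBy (fun _ => X) (ampl n X) := fun f _ hz =>
  eval_ampl X f (mem_ball_zero_iff.1 hz)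

theorem IsMultiplicationBy.add [CompleteSpace F] {φ ψ : EuclideanSpace ℂ (Fin n) → E →L[ℂ] F}
    {A B : DruryArveson n E →L[ℂ] DruryArveson n F}
    (hA : IsMultiplicationBy φ A) (hB : IsMultiplicationBy ψ B) :
    IsMultiplicationBy (fun z => φ z + ψ z) (A + B) := fun f z hz => by
  rw [add_apply, eval_add _ _ (mem_ball_zero_iff.1 hz), hA f z hz, hB f z hz]
  rfl

theorem IsMultiplicationBy.comp {φ : EuclideanSpace ℂ (Fin n) → F →L[ℂ] G}
    {ψ : EuclideanSpace ℂ (Fin n) → E →L[ℂ] F}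
    {A : DruryArveson n F →L[ℂ] DruryArveson n G} {B : DruryArveson n E →L[ℂ] DruryArveson n F}
    (hA : IsMultiplicationBy φ A) (hB : IsMultiplicationBy ψ B) :
    IsMultiplicationBy (fun z => φ z ∘L ψ z) (A ∘L B) := fun f z hz => by
  rw [comp_apply, comp_apply, hA _ z hz, hB f z hz]

theorem IsMultiplicationBy.congr {φ ψ : EuclideanSpace ℂ (Fin n) → E →L[ℂ] F}
    {A : DruryArveson n E →L[ℂ] DruryArveson n F} (hA : IsMultiplicationBy φ A)
    (h : ∀ z, ‖z‖ < 1 → φ z = ψ z) : IsMultiplicationBy ψ A := fun f z hz => by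
  rw [hA f z hz, h z (mem_ball_zero_iff.1 hz)]

theorem IsMultiplicationBy.sum [CompleteSpace E] [CompleteSpace F] {ι : Type*} (s : Finset ι)
    {φ : ι → EuclideanSpace ℂ (Fin n) → E →L[ℂ] F}
    {A : ι → DruryArveson n E →L[ℂ] DruryArveson n F}
    (h : ∀ i ∈ s, IsMultiplicationBy (φ i) (A i)) :
    IsMultiplicationBy (fun z => ∑ i ∈ s, φ i z) (∑ i ∈ s, A i) := by
  classical
  induction s using Finset.induction_on with
  | empty =>
    have h0 : ampl n (0 : E →L[ℂ] F) = 0 := rfl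
    simpa [h0] using isMultiplicationBy_ampl (n := n) (0 : E →L[ℂ] F)
  | insert i s hi ih =>
    simp only [Finset.sum_insert hi]
    exact (h i (Finset.mem_insert_self _ _)).add
      (ih fun j hj => h j (Finset.mem_insert_of_mem hj))

theorem IsMultiplicationBy.pow [CompleteSpace E] {φ : EuclideanSpace ℂ (Fin n) → E →L[ℂ] E}
    {A : DruryArveson n E →L[ℂ] DruryArveson n E} (hA : IsMultiplicationBy φ A) (k : ℕ) :
    IsMultiplicationBy (fun z => φ z ^ k) (A ^ k) := by
  induction k with
  | zero => simp only [pow_zero]; exact isMultiplicationBy_ampl (n := n) (1 : E →L[ℂ] E)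
  | succ k ih => simp only [pow_succ]; exact ih.comp hA

theorem isMultiplicationBy_diagId [CompleteSpace E] [CompleteSpace F] [CompleteSpace G]
    {φ : EuclideanSpace ℂ (Fin n) → E →L[ℂ] F} {A : DruryArveson n E →L[ℂ] DruryArveson n F}
    (hA : IsMultiplicationBy φ A) :
    IsMultiplicationBy (fun z => inl F G ∘L φ z ∘L WithLp.fstL 2 ℂ E G +
      inr F G ∘L WithLp.sndL 2 ℂ E G) (diagId G A) :=
  ((isMultiplicationBy_ampl _).comp (hA.comp (isMultiplicationBy_ampl _))).add
    ((isMultiplicationBy_ampl _).comp (isMultiplicationBy_ampl _))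

theorem isMultiplicationBy_ampl_comp_diagId {X Y : Type*} [NormedAddCommGroup X]
    [InnerProductSpace ℂ X] [CompleteSpace X] [NormedAddCommGroup Y] [InnerProductSpace ℂ Y]
    [CompleteSpace E] [CompleteSpace F] [CompleteSpace G]
    {φ : EuclideanSpace ℂ (Fin n) → E →L[ℂ] F} {A : DruryArveson n E →L[ℂ] DruryArveson n F}
    (hA : IsMultiplicationBy φ A) {g₁ : WithLp 2 (F × G) →L[ℂ] Y} {g₂ : X →L[ℂ] WithLp 2 (E × G)}
    {ψ : EuclideanSpace ℂ (Fin n) → X →L[ℂ] Y}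
    (h : ∀ z, ‖z‖ < 1 → ∀ x, g₁ (inl _ _ (φ z (g₂ x).fst) + inr _ _ (g₂ x).snd) = ψ z x) :
    IsMultiplicationBy ψ (ampl n g₁ ∘L diagId G A ∘L ampl n g₂) :=
  ((isMultiplicationBy_ampl g₁).comp
    ((isMultiplicationBy_diagId hA).comp (isMultiplicationBy_ampl g₂))).congr
      fun z hz => ContinuousLinearMap.ext fun x => h z hz x

/-! ### Multiplication by a coordinate function -/

theorem gam_le_gam_add_single (α : Fin n → ℕ) (i : Fin n) : gam α ≤ gam (α + Pi.single i 1) := by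
  have h1 : (∏ j, (α j).factorial) * gam α = (∑ j, α j).factorial := Nat.multinomial_spec _ _
  have h2 : (∏ j, ((α + Pi.single i 1 : Fin n → ℕ) j).factorial) * gam (α + Pi.single i 1) =
    (∑ j, (α + Pi.single i 1 : Fin n → ℕ) j).factorial := Nat.multinomial_spec _ _
  have h3 : ∑ j, (α + Pi.single i 1 : Fin n → ℕ) j = ∑ j, α j + 1 := by
    simp [Finset.sum_add_distrib]
  have h4 : ∏ j, ((α + Pi.single i 1 : Fin n → ℕ) j).factorial =
      (α i + 1) * ∏ j, (α j).factorial := by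
    rw [← Finset.mul_prod_erase _ _ (Finset.mem_univ i),
      ← Finset.mul_prod_erase _ (fun j => (α j).factorial) (Finset.mem_univ i), ← mul_assoc,
      Pi.add_apply, Pi.single_eq_same, Nat.factorial_succ]
    congr 1
    refine Finset.prod_congr rfl fun j hj => ?_
    rw [Pi.add_apply, Pi.single_eq_of_ne (Finset.ne_of_mem_erase hj), add_zero]
  rw [h3, h4, Nat.factorial_succ, ← h1] at h2
  have hp : 0 < ∏ j, (α j).factorial := Finset.prod_pos fun j _ => Nat.factorial_pos _
  -- This identity together with `α i ≤ |α|` gives the monotonicity, which is what makes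
  -- multiplication by `zᵢ` a contraction.
  have h5 : (α i + 1) * gam (α + Pi.single i 1) = (∑ j, α j + 1) * gam α := by
    refine Nat.eq_of_mul_eq_mul_left hp ?_
    linarith
  have h6 : α i ≤ ∑ j, α j := Finset.single_le_sum (fun j _ => Nat.zero_le _) (Finset.mem_univ i)
  refine Nat.le_of_mul_le_mul_left (?_ : (α i + 1) * gam α ≤ _) (Nat.succ_pos (α i))
  rw [h5]
  gcongr

theorem injective_add_single (i : Fin n) :
    Function.Injective fun α : Fin n → ℕ => α + Pi.single i 1 :=
  add_left_injective _

theorem sub_add_single {α : Fin n → ℕ} {i : Fin n} (h : α i ≠ 0) :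
    α - Pi.single i 1 + Pi.single i 1 = α := by
  ext j
  by_cases hj : j = i
  · subst hj
    simp
    omega
  · simp [Pi.single_eq_of_ne hj]

theorem add_single_sub (α : Fin n → ℕ) (i : Fin n) :
    α + Pi.single i 1 - Pi.single i 1 = α := by
  ext j
  simp

/-- The coordinates of `zᵢ f`. -/
def shiftCoord (i : Fin n) (f : DruryArveson n E) (α : Fin n → ℕ) : E :=
  if α i = 0 then 0 else
    ((Real.sqrt (gam (α - Pi.single i 1) / gam α) : ℝ) : ℂ) • coord f (α - Pi.single i 1)

theorem shiftCoord_add_single (i : Fin n) (f : DruryArveson n E) (α : Fin n → ℕ) :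
    shiftCoord i f (α + Pi.single i 1) =
      ((Real.sqrt (gam α / gam (α + Pi.single i 1)) : ℝ) : ℂ) • coord f α := by
  rw [shiftCoord, if_neg (by simp), add_single_sub]

theorem shiftCoord_of_notMem_range (i : Fin n) (f : DruryArveson n E) {α : Fin n → ℕ}
    (h : α ∉ Set.range fun α : Fin n → ℕ => α + Pi.single i 1) : shiftCoord i f α = 0 := by
  rw [shiftCoord, if_pos]
  by_contra hα
  exact h ⟨_, sub_add_single hα⟩

theorem norm_shiftCoord_add_single_le (i : Fin n) (f : DruryArveson n E) (α : Fin n → ℕ) :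
    ‖shiftCoord i f (α + Pi.single i 1)‖ ≤ ‖coord f α‖ := by
  rw [shiftCoord_add_single, norm_smul, Complex.norm_real, Real.norm_of_nonneg (Real.sqrt_nonneg _)]
  refine mul_le_of_le_one_left (norm_nonneg _) (Real.sqrt_le_one.2 ?_)
  refine div_le_one_of_le₀ ?_ (Nat.cast_nonneg _)
  exact_mod_cast gam_le_gam_add_single α i

theorem summable_norm_shiftCoord_sq (i : Fin n) (f : DruryArveson n E) :
    Summable fun α => ‖shiftCoord i f α‖ ^ 2 := by
  rw [← (injective_add_single i).summable_iff fun α hα => by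
    rw [shiftCoord_of_notMem_range i f hα, norm_zero, zero_pow two_ne_zero]]
  refine Summable.of_nonneg_of_le (fun _ => sq_nonneg _) (fun α => ?_) (summable_norm_coord_sq f)
  exact pow_le_pow_left₀ (norm_nonneg _) (norm_shiftCoord_add_single_le i f α) 2

theorem tsum_norm_shiftCoord_sq_le (i : Fin n) (f : DruryArveson n E) :
    ∑' α, ‖shiftCoord i f α‖ ^ 2 ≤ ‖f‖ ^ 2 := by
  rw [norm_sq_eq_tsum_coord, ← (injective_add_single i).tsum_eq]
  · refine Summable.tsum_le_tsum (fun α => ?_)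
      ((summable_norm_shiftCoord_sq i f).comp_injective (injective_add_single i))
      (summable_norm_coord_sq f)
    exact pow_le_pow_left₀ (norm_nonneg _) (norm_shiftCoord_add_single_le i f α) 2
  · intro α hα
    by_contra h
    exact hα (by
      show ‖shiftCoord i f α‖ ^ 2 = 0
      rw [shiftCoord_of_notMem_range i f h, norm_zero, zero_pow two_ne_zero])

/-- The coordinate multiplication operator `f ↦ zᵢ f`. -/
def coordMul (E : Type*) [NormedAddCommGroup E] [InnerProductSpace ℂ E] (i : Fin n) :
    DruryArveson n E →L[ℂ] DruryArveson n E :=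
  LinearMap.mkContinuous
    { toFun := fun f => (⟨shiftCoord i f, memℓp_gen (by
        simpa only [ENNReal.toReal_ofNat, Real.rpow_ofNat] using
          summable_norm_shiftCoord_sq i f)⟩ : lp (fun _ : Fin n → ℕ => E) 2)
      map_add' := fun f g => DruryArveson.ext_coord fun α => by
        change shiftCoord i (f + g) α = shiftCoord i f α + shiftCoord i g α
        unfold shiftCoord
        split_ifs
        · simp
        · rw [coord_add, smul_add]
      map_smul' := fun c f => DruryArveson.ext_coord fun α => by
        change shiftCoord i (c • f) α = c • shiftCoord i f α
        unfold shiftCoord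
        split_ifs
        · simp
        · exact smul_comm _ c _ } 1 fun f => by
    rw [one_mul]
    refine le_of_sq_le_sq ?_ (norm_nonneg f)
    exact (norm_sq_eq_tsum_coord _).trans_le (tsum_norm_shiftCoord_sq_le i f)

theorem coord_coordMul (i : Fin n) (f : DruryArveson n E) (α : Fin n → ℕ) :
    coord (coordMul E i f) α = shiftCoord i f α := rfl

theorem coeff_coordMul_add_single (i : Fin n) (f : DruryArveson n E) (α : Fin n → ℕ) :
    coeff (coordMul E i f) (α + Pi.single i 1) = coeff f α := by
  rw [coeff, coord_coordMul, shiftCoord_add_single, smul_smul, coeff, ← Complex.ofReal_mul,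
    ← Real.sqrt_mul (Nat.cast_nonneg _), mul_div_cancel₀]
  exact_mod_cast (gam_pos _).ne'

theorem isMultiplicationBy_coordMul (i : Fin n) :
    IsMultiplicationBy (fun z => z i • (1 : E →L[ℂ] E)) (coordMul E i) := fun f z _ => by
  rw [smul_apply, one_apply_eq_self, eval, eval, ← (injective_add_single i).tsum_eq]
  · rw [← tsum_const_smul'']
    refine tsum_congr fun α => ?_
    rw [coeff_coordMul_add_single, smul_smul]
    congr 1
    simp only [Pi.add_apply, pow_add, Finset.prod_mul_distrib]
    rw [mul_comm]
    congr 1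
    rw [Finset.prod_eq_single i]
    · simp
    · intro j _ hj
      rw [Pi.single_eq_of_ne hj, pow_zero]
    · simp
  · intro α hα
    by_contra h
    exact hα (by
      show (∏ j, z j ^ α j) • coeff (coordMul E i f) α = 0
      rw [coeff, coord_coordMul, shiftCoord_of_notMem_range i f h, smul_zero, smul_zero])

theorem exists_isMultiplicationBy_row_comp [CompleteSpace E] [CompleteSpace F]
    (A : F →L[ℂ] PiLp 2 (fun _ : Fin n => E)) :
    ∃ B : DruryArveson n F →L[ℂ] DruryArveson n E,
      IsMultiplicationBy (fun z => row (fun i => z i • (1 : E →L[ℂ] E)) ∘L A) B := by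
  refine ⟨∑ i, coordMul E i ∘L ampl n (PiLp.proj 2 (fun _ : Fin n => E) i ∘L A),
    IsMultiplicationBy.congr (IsMultiplicationBy.sum _ fun i _ =>
      (isMultiplicationBy_coordMul i).comp (isMultiplicationBy_ampl _)) fun z _ => ?_⟩
  ext x
  simp [row_apply, sum_apply]

end Multipliers

/-! ### Defect spaces and characteristic functions of row contractions -/

section CharFun

variable {n : ℕ} {H : Type u} [NormedAddCommGroup H] [InnerProductSpace ℂ H] [CompleteSpace H]

theorem defect_eq (T : Fin n → H →L[ℂ] H) : defect T = defectOp (row T) := rfl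

theorem defectStar_eq (T : Fin n → H →L[ℂ] H) :
    defectStar T = defectOp (adjoint (row T)) := by
  rw [defectStar, defectOp, adjoint_adjoint]

theorem norm_adjoint_row_le {T : Fin n → H →L[ℂ] H} (hT : ‖row T‖ ≤ 1) :
    ‖adjoint (row T)‖ ≤ 1 := by
  rwa [LinearIsometryEquiv.norm_map]

theorem defectStar_mem (T : Fin n → H →L[ℂ] H) (h : H) :
    defectStar T h ∈ defectStarSpace T :=
  Submodule.le_topologicalClosure _ ⟨h, rfl⟩

theorem row_mem_defectStarSpace {T : Fin n → H →L[ℂ] H} (hT : ‖row T‖ ≤ 1)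
    {x : PiLp 2 (fun _ : Fin n => H)} (hx : x ∈ defectSpace T) : row T x ∈ defectStarSpace T := by
  refine map_mem_closure (row T).continuous hx ?_
  rintro _ ⟨y, rfl⟩
  refine ⟨row T y, ?_⟩
  rw [defectStar_eq, defect_eq]
  exact (apply_defectOp hT y).symm

/-- A self-adjoint operator with range in `S` vanishes on `Sᗮ`. -/
theorem defectOp_orthogonalProjection {X Y : Type*} [NormedAddCommGroup X] [InnerProductSpace ℂ X]
    [CompleteSpace X] [NormedAddCommGroup Y] [InnerProductSpace ℂ Y] [CompleteSpace Y]
    (A : X →L[ℂ] Y) (S : Submodule ℂ X) [S.HasOrthogonalProjection]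
    (hS : ∀ x, defectOp A x ∈ S) (x : X) :
    defectOp A (S.orthogonalProjectionOnto x : X) = defectOp A x := by
  rw [← sub_eq_zero, ← map_sub]
  refine ext_inner_right ℂ fun y => ?_
  rw [inner_defectOp_left, inner_zero_left, ← neg_sub, inner_neg_left, neg_eq_zero]
  exact Submodule.sub_starProjection_mem_orthogonal x |> fun h =>
    (Submodule.mem_orthogonal' _ _).1 h _ (hS y)

theorem defect_orthogonalProjection (T : Fin n → H →L[ℂ] H) (x : PiLp 2 (fun _ : Fin n => H)) :
    defect T ((defectSpace T).orthogonalProjectionOnto x : PiLp 2 (fun _ : Fin n => H)) =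
      defect T x :=
  defectOp_orthogonalProjection (row T) (defectSpace T)
    (fun y => Submodule.le_topologicalClosure _ ⟨y, rfl⟩) x

/-- With `ringInverse_spec`, this trades the resolvent for the fixed-point equation `h = Z (T* h +
w)`, which can be projected onto subspaces. -/
theorem ringInverse_apply_eq {T : Fin n → H →L[ℂ] H} (hT : ‖row T‖ ≤ 1)
    {z : EuclideanSpace ℂ (Fin n)} (hz : ‖z‖ < 1) {w : PiLp 2 (fun _ : Fin n => H)} {h : H}
    (hh : h = row (fun i => z i • (1 : H →L[ℂ] H)) (adjoint (row T) h + w)) :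
    Ring.inverse (1 - row (fun i => z i • (1 : H →L[ℂ] H)) ∘L adjoint (row T))
      (row (fun i => z i • (1 : H →L[ℂ] H)) w) = h := by
  have h1 : row (fun i => z i • (1 : H →L[ℂ] H)) w =
      (1 - row (fun i => z i • (1 : H →L[ℂ] H)) ∘L adjoint (row T)) h := by
    rw [sub_apply, one_apply_eq_self, comp_apply, eq_sub_iff_add_eq, ← map_add, add_comm w, ← hh]
  rw [h1, ← mul_apply_eq_comp, Ring.inverse_mul_cancel _ (isUnit_one_sub_row_comp T hT hz),
    one_apply_eq_self]

theorem ringInverse_spec {T : Fin n → H →L[ℂ] H} (hT : ‖row T‖ ≤ 1)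
    {z : EuclideanSpace ℂ (Fin n)} (hz : ‖z‖ < 1) (w : PiLp 2 (fun _ : Fin n => H)) {h : H}
    (hh : h = Ring.inverse (1 - row (fun i => z i • (1 : H →L[ℂ] H)) ∘L adjoint (row T))
      (row (fun i => z i • (1 : H →L[ℂ] H)) w)) :
    h = row (fun i => z i • (1 : H →L[ℂ] H)) (adjoint (row T) h + w) := by
  have h1 : (1 - row (fun i => z i • (1 : H →L[ℂ] H)) ∘L adjoint (row T)) h =
      row (fun i => z i • (1 : H →L[ℂ] H)) w := by
    rw [hh, ← mul_apply_eq_comp, Ring.mul_inverse_cancel _ (isUnit_one_sub_row_comp T hT hz),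
      one_apply_eq_self]
  rw [map_add, ← h1, sub_apply, one_apply_eq_self, comp_apply]
  abel

theorem charFun_apply {T : Fin n → H →L[ℂ] H} (hT : ‖row T‖ ≤ 1)
    {z : EuclideanSpace ℂ (Fin n)} (hz : ‖z‖ < 1) (x : defectSpace T) {h : H}
    (hh : h = row (fun i => z i • (1 : H →L[ℂ] H)) (adjoint (row T) h + defect T x)) :
    charFun T z x = (defectStarSpace T).orthogonalProjectionOnto
      (defectStar T h - row T x) := by
  simp only [charFun, restrictDefect, comp_apply, add_apply, Submodule.subtypeL_apply, neg_apply]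
  rw [ringInverse_apply_eq hT hz hh, neg_add_eq_sub]

/-- If `I - ZT*` has a finite Neumann series, then `θ_T` is a polynomial multiplier. -/
theorem exists_isMultiplicationBy_charFun (T : Fin n → H →L[ℂ] H) (m : ℕ)
    (h : ∀ z : EuclideanSpace ℂ (Fin n),
      (row (fun i => z i • (1 : H →L[ℂ] H)) ∘L adjoint (row T)) ^ m = 0) :
    ∃ Θ : DruryArveson n (defectSpace T) →L[ℂ] DruryArveson n (defectStarSpace T),
      IsMultiplicationBy (charFun T) Θ := by
  obtain ⟨B, hB⟩ := exists_isMultiplicationBy_row_comp (E := H) (adjoint (row T))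
  obtain ⟨C, hC⟩ := exists_isMultiplicationBy_row_comp (E := H)
    (defect T ∘L (defectSpace T).subtypeL)
  have hinv : IsMultiplicationBy (fun z => Ring.inverse
      (1 - row (fun i => z i • (1 : H →L[ℂ] H)) ∘L adjoint (row T)))
      (∑ k ∈ Finset.range m, B ^ k) := by
    refine (IsMultiplicationBy.sum (Finset.range m) fun k _ => hB.pow k).congr fun z _ => ?_
    set X := row (fun i => z i • (1 : H →L[ℂ] H)) ∘L adjoint (row T)
    have h1 : (∑ k ∈ Finset.range m, X ^ k) * (1 - X) = 1 := by
      rw [geom_sum_mul_neg, h z, sub_zero]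
    have h2 : (1 - X) * (∑ k ∈ Finset.range m, X ^ k) = 1 := by
      rw [mul_neg_geom_sum, h z, sub_zero]
    exact (Ring.inverse_unit (⟨1 - X, _, h2, h1⟩ : (H →L[ℂ] H)ˣ)).symm
  have hsum := (isMultiplicationBy_ampl (n := n) (restrictDefect T (-row T))).add
    ((isMultiplicationBy_ampl ((defectStarSpace T).orthogonalProjectionOnto ∘L defectStar T)).comp
      (hinv.comp hC))
  refine ⟨_, hsum.congr fun z _ => ?_⟩
  ext x
  simp [charFun, restrictDefect]

end CharFun

/-! ### Compressions to closed subspaces -/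

section Compression

variable {n : ℕ} {H : Type u} [NormedAddCommGroup H] [InnerProductSpace ℂ H] [CompleteSpace H]
  (S : Submodule ℂ H) [CompleteSpace S]

omit [CompleteSpace H] in
theorem row_compression (T : Fin n → H →L[ℂ] H) :
    row (fun i => compression S (T i)) =
      S.orthogonalProjectionOnto ∘L row T ∘L piMap n S.subtypeL := by
  ext x
  simp [row_apply, compression]

omit [CompleteSpace H] in
theorem norm_row_compression_le {T : Fin n → H →L[ℂ] H} (hT : ‖row T‖ ≤ 1) :
    ‖row (fun i => compression S (T i))‖ ≤ 1 := by
  rw [row_compression]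
  refine opNorm_le_bound _ zero_le_one fun x => ?_
  rw [comp_apply, comp_apply, one_mul]
  refine (Submodule.norm_orthogonalProjectionOnto_apply_le _ _).trans ?_
  refine ((row T).le_of_opNorm_le hT _).trans ?_
  rw [one_mul, norm_piMap_apply fun x => rfl]

theorem adjoint_piMap_subtypeL :
    adjoint (piMap n S.subtypeL) = piMap n S.orthogonalProjectionOnto := by
  rw [adjoint_piMap, Submodule.adjoint_subtypeL]

theorem adjoint_row_compression (T : Fin n → H →L[ℂ] H) (h : S) :
    adjoint (row fun i => compression S (T i)) h =
      piMap n S.orthogonalProjectionOnto (adjoint (row T) h) := by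
  rw [row_compression, adjoint_comp, adjoint_comp, adjoint_piMap_subtypeL,
    Submodule.adjoint_orthogonalProjectionOnto]
  rfl

omit [CompleteSpace H] in
theorem norm_piMap_orthogonalProjection_le (x : PiLp 2 (fun _ : Fin n => H)) :
    ‖piMap n S.orthogonalProjectionOnto x‖ ≤ ‖x‖ := by
  have h : ‖piMap n S.orthogonalProjectionOnto‖ ≤ 1 :=
    (norm_piMap_le _).trans (Submodule.orthogonalProjectionOnto_norm_le S)
  simpa using (piMap n S.orthogonalProjectionOnto).le_of_opNorm_le h x

omit [CompleteSpace H] in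
theorem orthogonalProjection_row_smul (z : EuclideanSpace ℂ (Fin n))
    (x : PiLp 2 (fun _ : Fin n => H)) :
    S.orthogonalProjectionOnto (row (fun i => z i • (1 : H →L[ℂ] H)) x) =
      row (fun i => z i • (1 : S →L[ℂ] S)) (piMap n S.orthogonalProjectionOnto x) := by
  simp [row_apply]

variable {S} {T : Fin n → H →L[ℂ] H} (hS : ∀ i, ∀ x ∈ S, T i x ∈ S)

omit [CompleteSpace H] in
include hS in
theorem row_piMap_of_invariant (x : PiLp 2 (fun _ : Fin n => S)) :
    row T (piMap n S.subtypeL x) = row (fun i => compression S (T i)) x := by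
  rw [row_apply, row_apply, Submodule.coe_sum]
  refine Finset.sum_congr rfl fun i _ => ?_
  exact (Submodule.starProjection_eq_self_iff.2 (hS i _ (x i).2)).symm

end Compression

/-! ### Row partial isometries and regularity -/

section Regular

variable {n : ℕ} {X : Type u} [NormedAddCommGroup X] [InnerProductSpace ℂ X] [CompleteSpace X]

/-- For a regular row partial isometry `A`, the characteristic function vanishes near `0`. -/
theorem row_adjoint_row_eq_of_disjoint {A : Fin n → X →L[ℂ] X}
    (hpi : ∀ x, row A (adjoint (row A) (row A x)) = row A x) {z : EuclideanSpace ℂ (Fin n)}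
    (hd : Disjoint (row fun i => A i - z i • (1 : X →L[ℂ] X)).range ((row A).range)ᗮ)
    {k : PiLp 2 (fun _ : Fin n => X)} (hk : row A k = 0) {g : X}
    (hg : g = row (fun i => z i • (1 : X →L[ℂ] X)) (adjoint (row A) g + k)) :
    row A (adjoint (row A) g) = g := by
  have hsub (x : PiLp 2 (fun _ : Fin n => X)) : row (fun i => A i - z i • (1 : X →L[ℂ] X)) x =
      row A x - row (fun i => z i • (1 : X →L[ℂ] X)) x := by
    simp [row_apply]
  -- For a partial isometry, `AA*` is the orthogonal projection onto `ran A`.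
  have h1 : g - row A (adjoint (row A) g) ∈ ((row A).range)ᗮ := by
    rw [Submodule.mem_orthogonal]
    rintro _ ⟨b, rfl⟩
    change inner ℂ (row A b) _ = 0
    rw [inner_sub_right, ← adjoint_inner_left (row A), adjoint_inner_right (row A), hpi, sub_self]
  have h2 : g - row A (adjoint (row A) g) ∈
      (row fun i => A i - z i • (1 : X →L[ℂ] X)).range := by
    -- Since `A k = 0` and `Z (A* g + k) = g`, the operator `A - Z` sends `A* g + k` to `AA* g - g`.
    refine ⟨-(adjoint (row A) g + k), ?_⟩
    change row (fun i => A i - z i • (1 : X →L[ℂ] X)) _ = _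
    rw [map_neg, hsub, ← hg, map_add, hk, add_zero, neg_sub]
  exact (sub_eq_zero.1 (Submodule.disjoint_def.1 hd _ h2 h1)).symm

omit [CompleteSpace X] in
theorem row_smul_smul (t : ℂ) (z : EuclideanSpace ℂ (Fin n)) :
    row (fun i => (t • z) i • (1 : X →L[ℂ] X)) = t • row (fun i => z i • (1 : X →L[ℂ] X)) := by
  ext x
  simp [row_apply, Finset.smul_sum, mul_smul]

/-- Regularity gives the identity only for small `z`. The state at `t z` depends holomorphically on
`t`, so the identity theorem carries it along the slice `t ↦ t z` from `t = 0` to `t = 1`. -/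
theorem IsRegularTuple.row_adjoint_row_eq {A : Fin n → X →L[ℂ] X} (hreg : IsRegularTuple A)
    (hA : ‖row A‖ ≤ 1) (hpi : ∀ x, row A (adjoint (row A) (row A x)) = row A x)
    {z : EuclideanSpace ℂ (Fin n)} (hz : ‖z‖ < 1)
    {k : PiLp 2 (fun _ : Fin n => X)} (hk : row A k = 0) {g : X}
    (hg : g = row (fun i => z i • (1 : X →L[ℂ] X)) (adjoint (row A) g + k)) :
    row A (adjoint (row A) g) = g := by
  obtain ⟨ε, hε, hreg⟩ := hreg
  let s : Set ℂ := {t | ‖t • z‖ < 1}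
  have hs : IsOpen s := isOpen_lt (by fun_prop) continuous_const
  have hconv : Convex ℝ s := by
    have : s = (fun t : ℂ => t • z) ⁻¹' Metric.ball 0 1 := by
      ext t; simp [s]
    rw [this]
    exact (convex_ball _ _).is_linear_preimage
      (IsLinearMap.mk (fun a b => add_smul a b z) fun c a => smul_assoc c a z)
  let G (t : ℂ) : X := Ring.inverse (1 - t • (row (fun i => z i • (1 : X →L[ℂ] X)) ∘L
    adjoint (row A))) (t • row (fun i => z i • (1 : X →L[ℂ] X)) k)
  have hG (t : ℂ) (ht : t ∈ s) :
      G t = row (fun i => (t • z) i • (1 : X →L[ℂ] X)) (adjoint (row A) (G t) + k) := by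
    refine ringInverse_spec hA ht k ?_
    rw [row_smul_smul, smul_comp]
    rfl
  let F (t : ℂ) : X := row A (adjoint (row A) (G t)) - G t
  have hdiff : DifferentiableOn ℂ F s := by
    intro t ht
    have hu : IsUnit (1 - t • (row (fun i => z i • (1 : X →L[ℂ] X)) ∘L adjoint (row A))) := by
      have := isUnit_one_sub_row_comp A hA ht
      rwa [row_smul_smul, smul_comp] at this
    have h1 : DifferentiableAt ℂ (fun t : ℂ =>
        1 - t • (row (fun i => z i • (1 : X →L[ℂ] X)) ∘L adjoint (row A))) t := by fun_prop
    have h2 : DifferentiableAt ℂ (fun t : ℂ => Ring.inverse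
        (1 - t • (row (fun i => z i • (1 : X →L[ℂ] X)) ∘L adjoint (row A)))) t := by
      obtain ⟨v, hv⟩ := hu
      refine DifferentiableAt.comp t (g := Ring.inverse) ?_ h1
      rw [← hv]
      exact differentiableAt_inverse v.isUnit
    have h3 : DifferentiableAt ℂ G t := h2.clm_apply (by fun_prop)
    have h4 : DifferentiableAt ℂ F t :=
      ((row A ∘L adjoint (row A)).differentiableAt.comp t h3).sub h3
    exact h4.differentiableWithinAt
  have h0 : (0 : ℂ) ∈ s := by simp [s]
  have hev : F =ᶠ[nhds 0] 0 := by
    have hc : Continuous fun t : ℂ => ‖t • z‖ := by fun_prop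
    have hlt : ∀ᶠ t in nhds (0 : ℂ), ‖t • z‖ < ε :=
      hc.continuousAt.eventually_lt continuousAt_const (by simpa using hε)
    filter_upwards [hlt, hs.mem_nhds h0] with t ht hts
    exact sub_eq_zero.2
      (row_adjoint_row_eq_of_disjoint hpi (hreg _ ht).2.disjoint hk (hG t hts))
  have h1s : (1 : ℂ) ∈ s := by simpa [s] using hz
  have hF := (hdiff.analyticOnNhd hs).eqOn_zero_of_preconnected_of_eventuallyEq_zero
    hconv.isPreconnected h0 hev h1s
  -- The state is unique, so the given solution is the value of the holomorphic family at `t = 1`.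
  have hg1 : G 1 = g := by
    have := ringInverse_apply_eq hA hz hg
    simpa [G] using this
  have : F 1 = 0 := hF
  rw [← hg1]
  exact sub_eq_zero.1 this

end Regular

/-! ### Polynomial characteristic functions -/

section Polynomial

variable {n : ℕ} {H : Type u} [NormedAddCommGroup H] [InnerProductSpace ℂ H]

theorem commute_monomial {X : H →L[ℂ] H} {T : Fin n → H →L[ℂ] H} (h : ∀ i, Commute X (T i))
    (α : Fin n → ℕ) : Commute X (monomial T α) := by
  refine Commute.list_prod_right _ _ fun y hy => ?_
  obtain ⟨i, rfl⟩ := (List.mem_ofFn' _ _).1 hy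
  exact (h i).pow_right _

variable [CompleteSpace H]

theorem adjoint_monomial (T : Fin n → H →L[ℂ] H) (hT : ∀ i j, T i * T j = T j * T i)
    (α : Fin n → ℕ) : adjoint (monomial T α) = monomial (fun i => adjoint (T i)) α := by
  induction n with
  | zero =>
    simp only [monomial, List.ofFn_zero, List.prod_nil]
    exact star_one _
  | succ n ih =>
    have h1 := ih (fun i => T i.succ) (fun i j => hT _ _) fun i => α i.succ
    simp only [monomial, List.ofFn_succ, List.prod_cons] at h1 ⊢
    have h2 : adjoint (T 0 ^ α 0) = adjoint (T 0) ^ α 0 := star_pow _ _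
    rw [mul_def, adjoint_comp, h1, h2]
    -- Taking adjoints reverses the product; commutativity restores the order.
    have hc (i : Fin n) : Commute (adjoint (T 0) ^ α 0) (adjoint (T i.succ)) := by
      refine Commute.pow_left ?_ _
      have := congrArg star (hT i.succ 0)
      rwa [star_mul, star_mul] at this
    exact (commute_monomial hc fun i => α i.succ).eq.symm

/-- Restricting to `𝓓_T` and projecting to `𝓓_{T*}` loses nothing: `D_T` vanishes on the complement
of `𝓓_T`, and `B` already maps into `𝓓_{T*}`. -/
theorem restrictDefect_eq_zero {T : Fin n → H →L[ℂ] H} {B : PiLp 2 (fun _ : Fin n => H) →L[ℂ] H}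
    (hB : ∀ x, B x ∈ defectStarSpace T) (h : restrictDefect T (B ∘L defect T) = 0)
    (x : PiLp 2 (fun _ : Fin n => H)) : B (defect T x) = 0 := by
  have h1 := DFunLike.congr_fun h ((defectSpace T).orthogonalProjectionOnto x)
  simp only [restrictDefect, comp_apply, Submodule.subtypeL_apply, zero_apply,
    defect_orthogonalProjection] at h1
  have h2 := congrArg Subtype.val h1
  rwa [← Submodule.starProjection_apply, Submodule.starProjection_eq_self_iff.2 (hB _)] at h2

/-- The column `(γ_{β-e_j} T^{β-e_j} D_{T*} h)_j`. -/
def coeffColumn (T : Fin n → H →L[ℂ] H) (β : Fin n → ℕ) (h : H) : PiLp 2 (fun _ : Fin n => H) :=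
  WithLp.toLp 2 fun j => (gamPred β j : ℂ) • monomial T (β - Pi.single j 1) (defectStar T h)

/-- The coefficient `θ_{T,β}` comes from `B D_T`, and the column is `B* h`; so `D_T B* h = (B D_T)*
h = 0`. -/
theorem defect_coeffColumn {T : Fin n → H →L[ℂ] H} (hT : ∀ i j, T i * T j = T j * T i)
    {β : Fin n → ℕ} (hβ : 0 < len β) (h0 : charCoeff T β = 0) (h : H) :
    defect T (coeffColumn T β h) = 0 := by
  let B : PiLp 2 (fun _ : Fin n => H) →L[ℂ] H := ∑ j, (gamPred β j : ℂ) • (defectStar T ∘L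
    monomial (fun i => adjoint (T i)) (β - Pi.single j 1) ∘L PiLp.proj 2 (fun _ : Fin n => H) j)
  have hβ0 : β ≠ 0 := by
    rintro rfl
    simp [len] at hβ
  have hBD : restrictDefect T (B ∘L defect T) = 0 := by
    rw [← h0, charCoeff, if_neg hβ0]
    congr 1
    ext x
    simp [B, sum_apply]
  have hB (x) : B x ∈ defectStarSpace T := by
    simp only [B, sum_apply, smul_apply, comp_apply]
    exact Submodule.sum_mem _ fun j _ => Submodule.smul_mem _ _ (defectStar_mem T _)
  refine ext_inner_right ℂ fun x => ?_
  have h1 : (inner ℂ (coeffColumn T β h) (defect T x) : ℂ) = inner ℂ h (B (defect T x)) := by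
    simp only [B, sum_apply, smul_apply, comp_apply, inner_sum, PiLp.inner_apply, coeffColumn,
      inner_smul_left, inner_smul_right, Complex.conj_natCast]
    refine Finset.sum_congr rfl fun j _ => ?_
    rw [← adjoint_inner_right, adjoint_monomial T hT, defectStar_eq, inner_defectOp_left]
    rfl
  rw [inner_zero_left, defect_eq, inner_defectOp_left]
  rw [restrictDefect_eq_zero hB hBD, inner_zero_right] at h1
  exact h1

theorem len_add_single (α : Fin n → ℕ) (i : Fin n) : len (α + Pi.single i 1) = len α + 1 := by
  simp [len, Finset.sum_add_distrib]

theorem monomial_mem_shiftSpace (T : Fin n → H →L[ℂ] H) {m : ℕ} {α : Fin n → ℕ} (hα : m ≤ len α)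
    (h : H) : monomial T α (defectStar T h) ∈ shiftSpace T m :=
  Submodule.le_topologicalClosure _ (Submodule.subset_span ⟨α, h, hα, rfl⟩)

theorem shiftSpace_le_iff (T : Fin n → H →L[ℂ] H) {m : ℕ} {S : Submodule ℂ H}
    (hS : IsClosed (S : Set H)) :
    shiftSpace T m ≤ S ↔ ∀ α h, m ≤ len α → monomial T α (defectStar T h) ∈ S := by
  constructor
  · exact fun hle α h hα => hle (monomial_mem_shiftSpace T hα h)
  · intro h
    refine Submodule.topologicalClosure_minimal _ (Submodule.span_le.2 ?_) hS
    rintro _ ⟨α, y, hα, rfl⟩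
    exact h α y hα

theorem shiftSpace_antitone (T : Fin n → H →L[ℂ] H) : Antitone (shiftSpace T) := fun _ _ hkm =>
  (shiftSpace_le_iff T (Submodule.isClosed_topologicalClosure _)).2 fun _ h hα =>
    monomial_mem_shiftSpace T (hkm.trans hα) h

theorem apply_mem_shiftSpace_succ (T : Fin n → H →L[ℂ] H) (hT : ∀ i j, T i * T j = T j * T i)
    (m : ℕ) (i : Fin n) {x : H} (hx : x ∈ shiftSpace T m) : T i x ∈ shiftSpace T (m + 1) := by
  have hcl : IsClosed ((Submodule.comap (T i).toLinearMap (shiftSpace T (m + 1)) :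
      Submodule ℂ H) : Set H) :=
    (Submodule.isClosed_topologicalClosure _).preimage (T i).continuous
  suffices hle : shiftSpace T m ≤
      Submodule.comap (T i).toLinearMap (shiftSpace T (m + 1)) from hle hx
  refine (shiftSpace_le_iff T hcl).2 fun α h hα => ?_
  change (T i * monomial T α) (defectStar T h) ∈ shiftSpace T (m + 1)
  rw [mul_monomial T hT]
  exact monomial_mem_shiftSpace T (by rw [len_add_single]; omega) h

/-- For `|β| > m` the column `c` of `coeffColumn` is killed by `D_T`, that is, `T*T c = c`. Its
entries lie in `𝓜`, so compressing gives `A*A c = c`, and `AA*` fixes `A c`, a nonzero multiple of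
`T^β D_{T*} h`. The vectors with `β = α + e_j`, `|α| ≥ m`, span a dense subspace of `ran A`. -/
theorem row_shiftPart_partialIsometry {T : Fin n → H →L[ℂ] H} {m : ℕ}
    (hT : IsCommutingRowContraction T) (hpoly : ∀ β, m < len β → charCoeff T β = 0)
    (x : PiLp 2 (fun _ : Fin n => shiftSpace T m)) :
    row (shiftPart T m) (adjoint (row (shiftPart T m)) (row (shiftPart T m) x)) =
      row (shiftPart T m) x := by
  let S := shiftSpace T m
  let A := row (shiftPart T m)
  change A (adjoint A (A x)) = A x
  have hinv : ∀ i, ∀ x ∈ S, T i x ∈ S := fun i x hx => apply_mem_shiftSpace T hT.comm m i hx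
  have hAT (c : PiLp 2 (fun _ : Fin n => S)) : row T (piMap n S.subtypeL c) = A c :=
    row_piMap_of_invariant hinv c
  have key (j : Fin n) (y : H) (hy : y ∈ S) :
      (A (adjoint A (S.orthogonalProjectionOnto (T j y))) : H) = T j y := by
    let C : H →L[ℂ] H := S.subtypeL ∘L A ∘L adjoint A ∘L S.orthogonalProjectionOnto ∘L T j - T j
    suffices h : S ≤ C.ker from sub_eq_zero.1 (h hy)
    refine (shiftSpace_le_iff T C.isClosed_ker).2 fun α h hα => ?_
    change (A (adjoint A (S.orthogonalProjectionOnto (T j _))) : H) - T j _ = 0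
    rw [sub_eq_zero]
    -- The degrees match exactly: `|α| ≥ m` makes `|β| ≥ m + 1`, where the coefficient vanishes,
    -- while the column entries have degree `|β| - 1 ≥ m`, which puts them in `𝓜`.
    set β : Fin n → ℕ := α + Pi.single j 1 with hβ
    have hlen : len β = len α + 1 := len_add_single α j
    have hTj : T j (monomial T α (defectStar T h)) = monomial T β (defectStar T h) := by
      rw [hβ, ← mul_monomial T hT.comm]; rfl
    have hmemβ : monomial T β (defectStar T h) ∈ S := monomial_mem_shiftSpace T (by omega) h
    have hpred (i : Fin n) (hi : β i ≠ 0) : β - Pi.single i 1 + Pi.single i 1 = β :=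
      sub_add_single hi
    have hmem (i : Fin n) : coeffColumn T β h i ∈ S := by
      change (gamPred β i : ℂ) • monomial T (β - Pi.single i 1) (defectStar T h) ∈ S
      by_cases hi : β i = 0
      · simp [gamPred, hi]
      · refine Submodule.smul_mem _ _ (monomial_mem_shiftSpace T ?_ h)
        have := len_add_single (β - Pi.single i 1) i
        rw [hpred i hi] at this
        omega
    let c : PiLp 2 (fun _ : Fin n => S) := WithLp.toLp 2 fun i => ⟨coeffColumn T β h i, hmem i⟩
    have hc : piMap n S.subtypeL c = coeffColumn T β h := rfl
    have hD : adjoint (row T) (row T (coeffColumn T β h)) = coeffColumn T β h :=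
      (defectOp_eq_zero_iff hT.contr _).1
        (defect_coeffColumn hT.comm (by omega) (hpoly β (by omega)) h)
    have hAc : (A c : H) = ((∑ i, gamPred β i : ℕ) : ℂ) • monomial T β (defectStar T h) := by
      rw [← hAT, hc, row_apply, Nat.cast_sum, Finset.sum_smul]
      refine Finset.sum_congr rfl fun i _ => ?_
      change T i ((gamPred β i : ℂ) • monomial T (β - Pi.single i 1) (defectStar T h)) = _
      rw [map_smul]
      by_cases hi : β i = 0
      · simp [gamPred, hi]
      · congr 1
        change (T i * monomial T (β - Pi.single i 1)) _ = _
        rw [mul_monomial T hT.comm, hpred i hi]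
    have hAAc : adjoint A (A c) = c := by
      refine (adjoint_row_compression S T (A c)).trans ?_
      rw [← hAT, hc, hD, ← hc]
      ext i
      simp
    -- Pascal's rule would give `γ_β`, but a nonzero value suffices, and the `j`-th summand is
    -- positive because `β j ≠ 0`.
    have hg : ((∑ i, gamPred β i : ℕ) : ℂ) ≠ 0 := by
      rw [Nat.cast_ne_zero]
      refine (Finset.sum_pos' (fun _ _ => Nat.zero_le _) ⟨j, Finset.mem_univ _, ?_⟩).ne'
      have : β j ≠ 0 := by simp [hβ]
      rw [gamPred, if_neg this]
      exact gam_pos _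
    have hAc' : A c = ((∑ i, gamPred β i : ℕ) : ℂ) •
        (⟨monomial T β (defectStar T h), hmemβ⟩ : S) := Subtype.ext hAc
    have h2 : A (adjoint A (A c)) = A c := by rw [hAAc]
    rw [hAc', map_smul, map_smul] at h2
    have h3 := smul_right_injective S hg h2
    rw [hTj]
    have h4 : S.orthogonalProjectionOnto (monomial T β (defectStar T h)) =
        ⟨monomial T β (defectStar T h), hmemβ⟩ :=
      Submodule.orthogonalProjectionOnto_mem_subspace_eq_self
        (⟨monomial T β (defectStar T h), hmemβ⟩ : S)
    rw [h4, h3]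
  have hsum : A x = ∑ j, S.orthogonalProjectionOnto (T j (x j)) := by
    refine (row_apply _ x).trans ?_
    rfl
  rw [hsum, map_sum, map_sum]
  refine Finset.sum_congr rfl fun j _ => Subtype.ext ?_
  rw [key j _ (x j).2]
  exact (Submodule.starProjection_eq_self_iff.2 (hinv j _ (x j).2)).symm

end Polynomial

/-! ### The canonical representation -/

section Canonical

variable {n : ℕ} {H : Type u} [NormedAddCommGroup H] [InnerProductSpace ℂ H] [CompleteSpace H]
  {T : Fin n → H →L[ℂ] H} {m : ℕ}

theorem shiftSpace_le_zero (T : Fin n → H →L[ℂ] H) (m : ℕ) : shiftSpace T m ≤ shiftSpace T 0 :=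
  shiftSpace_antitone T (Nat.zero_le m)

theorem orthogonalProjection_nilSpace_of_mem_shiftSpace {x : H} (hx : x ∈ shiftSpace T m) :
    (nilSpace T m).orthogonalProjectionOnto x = 0 :=
  (Submodule.orthogonalProjectionOnto_eq_zero_iff).2
    ((Submodule.mem_orthogonal' _ _).2 fun _ hy => (Submodule.mem_orthogonal _ _).1 hy.2 x hx)

theorem orthogonalProjection_nilSpace_of_mem_orthogonal {x : H} (hx : x ∈ (shiftSpace T 0)ᗮ) :
    (nilSpace T m).orthogonalProjectionOnto x = 0 :=
  (Submodule.orthogonalProjectionOnto_eq_zero_iff).2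
    ((Submodule.mem_orthogonal _ _).2 fun y hy => (Submodule.mem_orthogonal _ _).1 hx y hy.1)

/-- `H = 𝓜 ⊕ H_nil ⊕ 𝒦ᗮ`. -/
theorem sub_sub_mem_orthogonal_shiftSpace (T : Fin n → H →L[ℂ] H) (m : ℕ) (h : H) :
    h - ((shiftSpace T m).orthogonalProjectionOnto h : H) -
      ((nilSpace T m).orthogonalProjectionOnto h : H) ∈ (shiftSpace T 0)ᗮ := by
  set p : H := ((shiftSpace T m).orthogonalProjectionOnto h : H)
  set k : H := ((shiftSpace T 0).orthogonalProjectionOnto h : H)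
  have hp : p ∈ shiftSpace T m := Subtype.property _
  have hk : k ∈ shiftSpace T 0 := Subtype.property _
  have hp' : h - p ∈ (shiftSpace T m)ᗮ := Submodule.sub_starProjection_mem_orthogonal h
  have hk' : h - k ∈ (shiftSpace T 0)ᗮ := Submodule.sub_starProjection_mem_orthogonal h
  have hkp : k - p ∈ nilSpace T m := by
    refine ⟨sub_mem hk (shiftSpace_le_zero T m hp), ?_⟩
    have := sub_mem hp' (Submodule.orthogonal_le (shiftSpace_le_zero T m) hk')
    rwa [sub_sub_sub_cancel_left] at this
  -- As `𝓜 ⊆ 𝒦`, the projection onto `𝒦 ⊖ 𝓜` is the difference of the projections onto `𝒦` and `𝓜`.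
  have hq : (nilSpace T m).orthogonalProjectionOnto h = ⟨k - p, hkp⟩ := by
    have h1 : h = (h - k) + p + (⟨k - p, hkp⟩ : nilSpace T m) := by simp
    conv_lhs => rw [h1]
    rw [map_add, map_add, orthogonalProjection_nilSpace_of_mem_orthogonal hk',
      orthogonalProjection_nilSpace_of_mem_shiftSpace hp,
      Submodule.orthogonalProjectionOnto_mem_subspace_eq_self]
    simp
  rw [hq]
  simpa using hk'

theorem adjoint_apply_mem_orthogonal_shiftSpace (hT : ∀ i j, T i * T j = T j * T i) {k : ℕ}
    {x : H} (hx : x ∈ (shiftSpace T (k + 1))ᗮ) (i : Fin n) :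
    adjoint (T i) x ∈ (shiftSpace T k)ᗮ := by
  rw [Submodule.mem_orthogonal] at hx ⊢
  intro y hy
  rw [adjoint_inner_right]
  exact hx _ (apply_mem_shiftSpace_succ T hT k i hy)

theorem adjoint_compression_nilSpace (i : Fin n) (u : nilSpace T m) :
    adjoint (nilPart T m i) u = (nilSpace T m).orthogonalProjectionOnto (adjoint (T i) u) := by
  rw [nilPart, compression, adjoint_comp, adjoint_comp, Submodule.adjoint_orthogonalProjectionOnto,
    Submodule.adjoint_subtypeL]
  rfl

/-- `T_i* u` has no component in `𝓜`, so `N_i* u` differs from it only by a vector of `𝒦ᗮ`, which is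
orthogonal to every `shiftSpace T k`. Thus `N_i*` lowers the filtration just as `T_i*` does. -/
theorem adjoint_nilPart_mem_orthogonal (hT : ∀ i j, T i * T j = T j * T i) {k : ℕ}
    {u : nilSpace T m} (hu : (u : H) ∈ (shiftSpace T (k + 1))ᗮ) (i : Fin n) :
    (adjoint (nilPart T m i) u : H) ∈ (shiftSpace T k)ᗮ := by
  have hM : ((shiftSpace T m).orthogonalProjectionOnto (adjoint (T i) (u : H)) : H) = 0 := by
    rw [ZeroMemClass.coe_eq_zero, Submodule.orthogonalProjectionOnto_eq_zero_iff]
    exact adjoint_apply_mem_orthogonal_shiftSpace hT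
      (Submodule.orthogonal_le (shiftSpace_antitone T (Nat.le_succ m)) u.2.2) i
  have h1 := sub_sub_mem_orthogonal_shiftSpace T m (adjoint (T i) (u : H))
  rw [hM, sub_zero, ← adjoint_compression_nilSpace] at h1
  have h2 := sub_mem (adjoint_apply_mem_orthogonal_shiftSpace hT hu i)
    (Submodule.orthogonal_le (shiftSpace_antitone T (Nat.zero_le k)) h1)
  rwa [sub_sub_cancel] at h2

/-- Each application of `ZN* = ∑ zᵢ Nᵢ*` lowers the level `k` in `(shiftSpace T k)ᗮ` by one. `H_nil`
starts at level `m`, and at level `0` it meets `𝒦ᗮ` only in zero. -/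
theorem row_smul_comp_adjoint_row_nilPart_pow (hT : ∀ i j, T i * T j = T j * T i)
    (z : EuclideanSpace ℂ (Fin n)) :
    (row (fun i => z i • (1 : nilSpace T m →L[ℂ] nilSpace T m)) ∘L
      adjoint (row (nilPart T m))) ^ m = 0 := by
  set X := row (fun i => z i • (1 : nilSpace T m →L[ℂ] nilSpace T m)) ∘L
      adjoint (row (nilPart T m))
  have key (k : ℕ) : ∀ u : nilSpace T m, (u : H) ∈ (shiftSpace T k)ᗮ → (X ^ k) u = 0 := by
    induction k with
    | zero =>
      intro u hu
      have := Submodule.inner_right_of_mem_orthogonal u.2.1 hu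
      rw [inner_self_eq_zero, ZeroMemClass.coe_eq_zero] at this
      rw [this, map_zero]
    | succ k ih =>
      intro u hu
      rw [pow_succ, mul_apply_eq_comp]
      refine ih _ ?_
      simp only [X, comp_apply, row_apply, adjoint_row_apply, smul_apply, one_apply_eq_self,
        Submodule.coe_sum, Submodule.coe_smul]
      exact Submodule.sum_mem _ fun i _ =>
        Submodule.smul_mem _ _ (adjoint_nilPart_mem_orthogonal hT hu i)
  ext u
  rw [key m u u.2.2]
  rfl

theorem defectStar_eq_zero_of_mem_orthogonal {x : H} (hx : x ∈ (shiftSpace T 0)ᗮ) :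
    defectStar T x = 0 := by
  refine ext_inner_left ℂ fun y => ?_
  rw [inner_zero_right, defectStar_eq, ← inner_defectOp_left, ← defectStar_eq]
  have := monomial_mem_shiftSpace T (m := 0) (α := 0) (Nat.zero_le _) y
  have h1 : monomial T 0 = 1 := by simp [monomial]
  rw [h1] at this
  exact Submodule.inner_right_of_mem_orthogonal this hx

/-- The `𝓜`-component of the state of the system realising a polynomial characteristic function
neither reaches `H_nil` nor contributes to the output. -/
theorem adjoint_row_eq_and_defectStar_eq_zero (hT : IsCommutingRowContraction T)
    {g : shiftSpace T m}
    (hg : row (shiftPart T m) (adjoint (row (shiftPart T m)) g) = g) :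
    adjoint (row T) g = piMap n (shiftSpace T m).subtypeL (adjoint (row (shiftPart T m)) g) ∧
      defectStar T g = 0 := by
  set A := row (shiftPart T m)
  set u := piMap n (shiftSpace T m).subtypeL (adjoint A g)
  have hTu : row T u = g := by
    have := row_piMap_of_invariant
      (fun i x hx => apply_mem_shiftSpace T hT.comm m i hx) (adjoint A g)
    exact this.trans (congrArg Subtype.val hg)
  have hA : ‖A‖ ≤ 1 := norm_row_compression_le _ hT.contr
  have hu : ‖u‖ ≤ ‖(g : H)‖ := by
    rw [norm_piMap_apply fun _ => rfl]
    simpa using (adjoint A).le_of_opNorm_le (norm_adjoint_row_le hA) g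
  have hTg : ‖adjoint (row T) (g : H)‖ ≤ ‖(g : H)‖ := by
    simpa using (adjoint (row T)).le_of_opNorm_le (norm_adjoint_row_le hT.contr) (g : H)
  -- Since `T u = g`, `‖T* g - u‖² = ‖T* g‖² - 2‖g‖² + ‖u‖²`, and both outer terms are at most
  -- `‖g‖²`.
  have h1 : adjoint (row T) (g : H) = u := by
    have h2 := norm_sub_sq (𝕜 := ℂ) (adjoint (row T) (g : H)) u
    rw [adjoint_inner_left, hTu, inner_self_eq_norm_sq] at h2
    have h3 : ‖adjoint (row T) (g : H) - u‖ ^ 2 ≤ 0 := by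
      have := pow_le_pow_left₀ (norm_nonneg _) hu 2
      have := pow_le_pow_left₀ (norm_nonneg _) hTg 2
      linarith
    rw [← sub_eq_zero, ← norm_eq_zero]
    exact pow_eq_zero_iff two_ne_zero |>.1 (le_antisymm h3 (sq_nonneg _))
  refine ⟨h1, ?_⟩
  rw [defectStar_eq, defectOp_eq_zero_iff (norm_adjoint_row_le hT.contr), adjoint_adjoint, h1, hTu]

/-- On `ran A*` the partial isometry `A` is isometric and agrees with `T`, so `D_T` vanishes there;
this is the adjoint statement. It says that the input to the `𝓜` component lies in `ker A`, as
`IsRegularTuple.row_adjoint_row_eq` requires. -/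
theorem row_shiftPart_piMap_defect (hT : IsCommutingRowContraction T)
    (hpi : ∀ x, row (shiftPart T m) (adjoint (row (shiftPart T m)) (row (shiftPart T m) x)) =
      row (shiftPart T m) x) (x : PiLp 2 (fun _ : Fin n => H)) :
    row (shiftPart T m) (piMap n (shiftSpace T m).orthogonalProjectionOnto (defect T x)) = 0 := by
  set A := row (shiftPart T m)
  refine ext_inner_left ℂ fun a => ?_
  have hTu (b) : row T (piMap n (shiftSpace T m).subtypeL b) = (A b : H) :=
    row_piMap_of_invariant (fun i x hx => apply_mem_shiftSpace T hT.comm m i hx) b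
  have hb : defect T (piMap n (shiftSpace T m).subtypeL (adjoint A a)) = 0 := by
    have h1 := norm_defectOp_sq hT.contr (piMap n (shiftSpace T m).subtypeL (adjoint A a))
    rw [hTu, norm_piMap_apply fun _ => rfl, ← Submodule.coe_norm] at h1
    have h2 : (inner ℂ (A (adjoint A a)) (A (adjoint A a)) : ℂ) =
        inner ℂ (adjoint A a) (adjoint A a) := by
      rw [← adjoint_inner_left, adjoint_inner_right, hpi, adjoint_inner_right]
    simp only [inner_self_eq_norm_sq_to_K] at h2
    have h3 : ‖A (adjoint A a)‖ ^ 2 = ‖adjoint A a‖ ^ 2 := by exact_mod_cast h2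
    rw [h3, sub_self] at h1
    exact norm_eq_zero.1 (pow_eq_zero_iff two_ne_zero |>.1 h1)
  rw [inner_zero_right, ← adjoint_inner_left, ← adjoint_piMap_subtypeL, adjoint_inner_right,
    defect_eq, ← inner_defectOp_left, ← defect_eq, hb, inner_zero_left]

theorem charFun_apply_eq_nilSpace (hT : IsCommutingRowContraction T)
    (hpoly : ∀ β, m < len β → charCoeff T β = 0) (hreg : IsRegularTuple (shiftPart T m))
    {z : EuclideanSpace ℂ (Fin n)} (hz : ‖z‖ < 1) (x : defectSpace T) :
    ∃ h : nilSpace T m,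
      h = row (fun i => z i • (1 : nilSpace T m →L[ℂ] nilSpace T m))
        (adjoint (row (nilPart T m)) h +
          piMap n (nilSpace T m).orthogonalProjectionOnto (defect T x)) ∧
      charFun T z x = (defectStarSpace T).orthogonalProjectionOnto
        (defectStar T h - row T x) := by
  have hpi := row_shiftPart_partialIsometry hT hpoly
  obtain ⟨h, hh⟩ : ∃ h : H, h = row (fun i => z i • (1 : H →L[ℂ] H))
      (adjoint (row T) h + defect T x) := ⟨_, ringInverse_spec hT.contr hz (defect T x) rfl⟩
  set h₁ := (shiftSpace T m).orthogonalProjectionOnto h with hh₁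
  set h₂ := (nilSpace T m).orthogonalProjectionOnto h with hh₂
  have h₃ : h - h₁ - h₂ ∈ (shiftSpace T 0)ᗮ := sub_sub_mem_orthogonal_shiftSpace T m h
  -- `𝓜` is invariant under `T`, so `P_𝓜 T* h` depends only on `P_𝓜 h`, and the `𝓜` component has a
  -- closed state equation.
  have hadj₁ : piMap n (shiftSpace T m).orthogonalProjectionOnto (adjoint (row T) h) =
      adjoint (row (shiftPart T m)) h₁ := by
    refine ext_inner_right ℂ fun b => ?_
    rw [adjoint_inner_left, hh₁, Submodule.inner_orthogonalProjectionOnto_eq_of_mem_right,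
      ← adjoint_piMap_subtypeL, adjoint_inner_left, adjoint_inner_left]
    rw [row_piMap_of_invariant fun i x hx => apply_mem_shiftSpace T hT.comm m i hx]
    rfl
  have hstate₁ : h₁ = row (fun i => z i • (1 : shiftSpace T m →L[ℂ] shiftSpace T m))
      (adjoint (row (shiftPart T m)) h₁ +
        piMap n (shiftSpace T m).orthogonalProjectionOnto (defect T x)) := by
    rw [← hadj₁, ← map_add, ← orthogonalProjection_row_smul, ← hh]
  obtain ⟨hT₁, hD₁⟩ := adjoint_row_eq_and_defectStar_eq_zero hT
    (hreg.row_adjoint_row_eq (norm_row_compression_le _ hT.contr) hpi hz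
      (row_shiftPart_piMap_defect hT hpi x) hstate₁)
  have hdecomp : h = h₁ + h₂ + (h - h₁ - h₂) := by abel
  -- Neither other component reaches `H_nil`: `T* h₁` stays in `𝓜ⁿ`, and the `T_i*` keep the
  -- remaining part in `𝒦ᗮ`.
  have hadj₂ : piMap n (nilSpace T m).orthogonalProjectionOnto (adjoint (row T) h) =
      adjoint (row (nilPart T m)) h₂ := by
    have e1 : piMap n (nilSpace T m).orthogonalProjectionOnto (adjoint (row T) (h₁ : H)) = 0 := by
      rw [hT₁]
      ext i
      simp [orthogonalProjection_nilSpace_of_mem_shiftSpace]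
    have e3 : piMap n (nilSpace T m).orthogonalProjectionOnto
        (adjoint (row T) (h - h₁ - h₂)) = 0 := by
      refine PiLp.ext fun i => ?_
      rw [piMap_apply, adjoint_row_apply]
      exact orthogonalProjection_nilSpace_of_mem_orthogonal
        (adjoint_apply_mem_orthogonal_shiftSpace hT.comm
          (Submodule.orthogonal_le (shiftSpace_antitone T (Nat.zero_le _)) h₃) i)
    rw [hdecomp, map_add, map_add, map_add, map_add, e1, e3, zero_add, add_zero]
    exact (adjoint_row_compression (nilSpace T m) T h₂).symm
  refine ⟨h₂, ?_, ?_⟩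
  · rw [← hadj₂, ← map_add, ← orthogonalProjection_row_smul, ← hh]
  · rw [charFun_apply hT.contr hz x hh]
    have : defectStar T h = defectStar T h₂ := by
      rw [hdecomp, map_add, map_add, hD₁, defectStar_eq_zero_of_mem_orthogonal h₃, zero_add,
        add_zero]
    rw [this]

end Canonical

/-! ### The factorization -/

section Factorization

variable {n : ℕ} {H : Type u} [NormedAddCommGroup H] [InnerProductSpace ℂ H] [CompleteSpace H]

/-- On `Sⁿ`, `‖D_T u‖² = ‖u‖² - ‖T u‖² ≤ ‖u‖² - ‖P T u‖² = ‖D_N u‖²`. Douglas' lemma gives a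
contraction `K` with `K D_N = D_T` on `Sⁿ`; `R` is `K*` cut down to the defect spaces. -/
theorem exists_defect_compression (T : Fin n → H →L[ℂ] H) (hT : ‖row T‖ ≤ 1) (S : Submodule ℂ H)
    [CompleteSpace S] {N : Fin n → S →L[ℂ] S} (hNS : ∀ i, N i = compression S (T i)) :
    ∃ R : defectSpace T →L[ℂ] defectSpace N, ‖R‖ ≤ 1 ∧
      ∀ x : defectSpace T, defect N (R x) =
        piMap n S.orthogonalProjectionOnto (defect T x) := by
  have hNrow : row N = S.orthogonalProjectionOnto ∘L row T ∘L piMap n S.subtypeL := by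
    rw [funext hNS, row_compression]
  have hN : ‖row N‖ ≤ 1 := by
    rw [funext hNS]
    exact norm_row_compression_le S hT
  obtain ⟨K, hK, hKD⟩ := exists_comp_eq_of_norm_le (defect T ∘L piMap n S.subtypeL) (defect N)
    fun u => by
      refine le_of_sq_le_sq ?_ (norm_nonneg _)
      rw [comp_apply, defect_eq, defect_eq, norm_defectOp_sq hT, norm_defectOp_sq hN,
        norm_piMap_apply fun _ => rfl]
      have : ‖row N u‖ ≤ ‖row T (piMap n S.subtypeL u)‖ := by
        rw [hNrow, comp_apply, comp_apply]
        exact Submodule.norm_orthogonalProjectionOnto_apply_le _ _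
      gcongr
  have hK' : ‖adjoint K‖ ≤ 1 := by rwa [LinearIsometryEquiv.norm_map]
  refine ⟨(defectSpace N).orthogonalProjectionOnto ∘L adjoint K ∘L (defectSpace T).subtypeL,
    opNorm_le_bound _ zero_le_one fun x => ?_, fun x => ?_⟩
  · rw [comp_apply, comp_apply]
    refine (Submodule.norm_orthogonalProjectionOnto_apply_le _ _).trans ?_
    exact (adjoint K).le_of_opNorm_le hK' _
  · rw [comp_apply, comp_apply]
    refine (defect_orthogonalProjection N _).trans ?_
    refine ext_inner_left ℂ fun u => ?_
    rw [defect_eq, ← inner_defectOp_left, adjoint_inner_right, ← defect_eq, hKD,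
      ← adjoint_piMap_subtypeL, adjoint_inner_right, comp_apply, defect_eq, inner_defectOp_left]
    rfl

/-- Both colligations preserve energy from the same state `h`. The next state of `N` is the
projection of that of `T`, hence no larger; subtracting the two balances leaves the inequality for
the outputs. -/
theorem norm_sq_output_le {T : Fin n → H →L[ℂ] H} (hT : ‖row T‖ ≤ 1) {S : Submodule ℂ H}
    [CompleteSpace S] {N : Fin n → S →L[ℂ] S} (hNS : ∀ i, N i = compression S (T i)) (h : S)
    {x : PiLp 2 (fun _ : Fin n => H)} {y : PiLp 2 (fun _ : Fin n => S)}
    (hxy : defect N y = piMap n S.orthogonalProjectionOnto (defect T x)) :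
    ‖defectStar T h - row T x‖ ^ 2 ≤
      ‖defectStar N h - row N y‖ ^ 2 + (‖x‖ ^ 2 - ‖y‖ ^ 2) := by
  have hN : ‖row N‖ ≤ 1 := by
    rw [funext hNS]
    exact norm_row_compression_le S hT
  have e2 := norm_sq_add_norm_sq_colligation hN h y
  have e3 := norm_sq_add_norm_sq_colligation hT (h : H) x
  have e4 : ‖adjoint (row N) h + defectOp (row N) y‖ ≤
      ‖adjoint (row T) (h : H) + defectOp (row T) x‖ := by
    have : adjoint (row N) h + defectOp (row N) y = piMap n S.orthogonalProjectionOnto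
        (adjoint (row T) (h : H) + defectOp (row T) x) := by
      rw [map_add, ← defect_eq, ← defect_eq, hxy, ← adjoint_row_compression, ← funext hNS]
    rw [this]
    exact norm_piMap_orthogonalProjection_le S _
  have e4' := pow_le_pow_left₀ (norm_nonneg _) e4 2
  rw [← defectStar_eq] at e2 e3
  rw [← Submodule.coe_norm] at e3
  linarith

/-! ### Dilating contractions to co-isometries and isometries -/

section Dilation

variable {X Y Z : Type*} [NormedAddCommGroup X] [InnerProductSpace ℂ X] [CompleteSpace X]
  [NormedAddCommGroup Y] [InnerProductSpace ℂ Y] [CompleteSpace Y]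
  [NormedAddCommGroup Z] [InnerProductSpace ℂ Z] [CompleteSpace Z]

/-- A contraction `Γ : X ⊕ Y → Z` extends to a co-isometry `X ⊕ (Y ⊕ Z) → Z`. -/
theorem exists_coisometry_extending {Γ : WithLp 2 (X × Y) →L[ℂ] Z} (hΓ : ‖Γ‖ ≤ 1) :
    ∃ g : WithLp 2 (X × WithLp 2 (Y × Z)) →L[ℂ] Z, IsCoisometry g ∧
      ∀ x y, g (WithLp.toLp 2 (x, WithLp.toLp 2 (y, 0))) = Γ (WithLp.toLp 2 (x, y)) := by
  have hΓ' : ‖adjoint Γ‖ ≤ 1 := by rwa [LinearIsometryEquiv.norm_map]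
  let P := WithLp.fstL 2 ℂ X (WithLp 2 (Y × Z))
  let Q := WithLp.sndL 2 ℂ X (WithLp 2 (Y × Z))
  -- The row `[Γ, D_{Γ*}]`, for which `g g* = ΓΓ* + D_{Γ*}² = I`; `k` below is its adjoint written
  -- out.
  let g : WithLp 2 (X × WithLp 2 (Y × Z)) →L[ℂ] Z :=
    Γ ∘L (inl X Y ∘L P + inr X Y ∘L WithLp.fstL 2 ℂ Y Z ∘L Q) +
      defectOp (adjoint Γ) ∘L WithLp.sndL 2 ℂ Y Z ∘L Q
  have hg (x y w) : g (WithLp.toLp 2 (x, WithLp.toLp 2 (y, w))) =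
      Γ (WithLp.toLp 2 (x, y)) + defectOp (adjoint Γ) w := by
    have : inl X Y x + inr X Y y = WithLp.toLp 2 (x, y) := by
      apply (WithLp.equiv 2 (X × Y)).injective
      simp [inl, inr]
    rw [← this]
    rfl
  let k : Z →L[ℂ] WithLp 2 (X × WithLp 2 (Y × Z)) :=
    inl X _ ∘L WithLp.fstL 2 ℂ X Y ∘L adjoint Γ +
      inr X _ ∘L (inl Y Z ∘L WithLp.sndL 2 ℂ X Y ∘L adjoint Γ +
        inr Y Z ∘L defectOp (adjoint Γ))
  have hk (w : Z) : k w = WithLp.toLp 2 ((adjoint Γ w).fst,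
      WithLp.toLp 2 ((adjoint Γ w).snd, defectOp (adjoint Γ) w)) := by
    have : inl Y Z (adjoint Γ w).snd + inr Y Z (defectOp (adjoint Γ) w) =
        WithLp.toLp 2 ((adjoint Γ w).snd, defectOp (adjoint Γ) w) := by
      apply (WithLp.equiv 2 (Y × Z)).injective
      simp [inl, inr]
    rw [← this]
    apply (WithLp.equiv 2 (X × WithLp 2 (Y × Z))).injective
    simp [k, inl, inr]
  have hadj : k = adjoint g := by
    rw [eq_adjoint_iff]
    intro w p
    obtain ⟨x, y, v, rfl⟩ : ∃ x y v, p = WithLp.toLp 2 (x, WithLp.toLp 2 (y, v)) :=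
      ⟨p.fst, p.snd.fst, p.snd.snd, rfl⟩
    rw [hk, hg, inner_add_right, ← inner_defectOp_left, ← adjoint_inner_left,
      WithLp.prod_inner_apply, WithLp.prod_inner_apply, WithLp.prod_inner_apply, ← add_assoc]
    rfl
  refine ⟨g, ?_, fun x y => by rw [hg, map_zero, add_zero]⟩
  rw [IsCoisometry, ← hadj]
  ext w
  rw [comp_apply, hk, hg, defectOp_comp_self hΓ', adjoint_adjoint]
  change Γ (adjoint Γ w) + (w - Γ (adjoint Γ w)) = w
  abel

/-- A contraction `R : X → Y` extends to the isometry `x ↦ R x ⊕ D_R x ⊕ 0`. -/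
theorem exists_isometry_extending {R : X →L[ℂ] Y} (hR : ‖R‖ ≤ 1) (Z : Type*)
    [NormedAddCommGroup Z] [InnerProductSpace ℂ Z] [CompleteSpace Z] :
    ∃ g : X →L[ℂ] WithLp 2 (Y × WithLp 2 (X × Z)), (∀ x, ‖g x‖ = ‖x‖) ∧
      ∀ x, g x = WithLp.toLp 2 (R x, WithLp.toLp 2 (defectOp R x, 0)) := by
  let g : X →L[ℂ] WithLp 2 (Y × WithLp 2 (X × Z)) :=
    inl Y _ ∘L R + inr Y _ ∘L inl X Z ∘L defectOp R
  have hg (x : X) : g x = WithLp.toLp 2 (R x, WithLp.toLp 2 (defectOp R x, 0)) := by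
    apply (WithLp.equiv 2 (Y × WithLp 2 (X × Z))).injective
    simp [g, inl, inr]
  refine ⟨g, fun x => ?_, hg⟩
  rw [hg, ← sq_eq_sq₀ (norm_nonneg _) (norm_nonneg _), WithLp.prod_norm_sq_eq_of_L2,
    WithLp.prod_norm_sq_eq_of_L2]
  change ‖R x‖ ^ 2 + (‖defectOp R x‖ ^ 2 + ‖(0 : Z)‖ ^ 2) = ‖x‖ ^ 2
  rw [norm_defectOp_sq hR, norm_zero]
  ring

/-- If two systems with outputs `a h - b x` and `c h - d (R x)` satisfy the energy inequality below,
then the first output is obtained from the second by a co-isometry and an isometry. -/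
theorem exists_coisometry_isometry {U W : Type*} [NormedAddCommGroup U] [InnerProductSpace ℂ U]
    [CompleteSpace U] [NormedAddCommGroup W] [InnerProductSpace ℂ W] [CompleteSpace W]
    (a : U →L[ℂ] Z) (b : X →L[ℂ] Z) (c : U →L[ℂ] W) (d : Y →L[ℂ] W) {R : X →L[ℂ] Y}
    (hR : ‖R‖ ≤ 1)
    (h : ∀ u x, ‖a u - b x‖ ^ 2 ≤ ‖c u - d (R x)‖ ^ 2 + (‖x‖ ^ 2 - ‖R x‖ ^ 2)) :
    ∃ (g₁ : WithLp 2 (W × WithLp 2 (X × Z)) →L[ℂ] Z)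
      (g₂ : X →L[ℂ] WithLp 2 (Y × WithLp 2 (X × Z))),
      IsCoisometry g₁ ∧ (∀ x, ‖g₂ x‖ = ‖x‖) ∧
      ∀ (φ : Y →L[ℂ] W) u x, φ (R x) = c u - d (R x) →
        g₁ (inl _ _ (φ (g₂ x).fst) + inr _ _ (g₂ x).snd) = a u - b x := by
  let A : WithLp 2 (U × X) →L[ℂ] Z := a ∘L WithLp.fstL 2 ℂ U X - b ∘L WithLp.sndL 2 ℂ U X
  let B : WithLp 2 (U × X) →L[ℂ] WithLp 2 (W × X) :=
    inl W X ∘L (c ∘L WithLp.fstL 2 ℂ U X - d ∘L R ∘L WithLp.sndL 2 ℂ U X) +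
      inr W X ∘L defectOp R ∘L WithLp.sndL 2 ℂ U X
  have hB (u : U) (x : X) : B (WithLp.toLp 2 (u, x)) =
      WithLp.toLp 2 (c u - d (R x), defectOp R x) := by
    apply (WithLp.equiv 2 (W × X)).injective
    simp [B, inl, inr]
  -- On pairs `(u, x)` the energy inequality says `‖A p‖ ≤ ‖B p‖`, the term `‖x‖² - ‖R x‖²` being
  -- `‖D_R x‖²`. State and input range independently, so `Γ` does not depend on `z`.
  obtain ⟨Γ, hΓ, hΓB⟩ := exists_comp_eq_of_norm_le A B fun p => by
    obtain ⟨u, x, rfl⟩ : ∃ u x, p = WithLp.toLp 2 (u, x) := ⟨p.fst, p.snd, rfl⟩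
    refine le_of_sq_le_sq ?_ (norm_nonneg _)
    rw [hB, WithLp.prod_norm_sq_eq_of_L2]
    change ‖a u - b x‖ ^ 2 ≤ ‖c u - d (R x)‖ ^ 2 + ‖defectOp R x‖ ^ 2
    rw [norm_defectOp_sq hR]
    exact h u x
  obtain ⟨g₁, hg₁, hg₁Γ⟩ := exists_coisometry_extending hΓ
  obtain ⟨g₂, hg₂, hg₂R⟩ := exists_isometry_extending hR Z
  refine ⟨g₁, g₂, hg₁, hg₂, fun φ u x hφ => ?_⟩
  have h1 : inl W (WithLp 2 (X × Z)) (φ (g₂ x).fst) + inr W (WithLp 2 (X × Z)) (g₂ x).snd =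
      WithLp.toLp 2 (c u - d (R x), WithLp.toLp 2 (defectOp R x, 0)) := by
    rw [hg₂R, ← hφ]
    apply (WithLp.equiv 2 (W × WithLp 2 (X × Z))).injective
    simp [inl, inr]
  rw [h1, hg₁Γ, ← hB, hΓB]
  rfl

end Dilation

theorem exists_charFun_factorization {T : Fin n → H →L[ℂ] H} {m : ℕ}
    (hT : IsCommutingRowContraction T) (hpoly : ∀ β, m < len β → charCoeff T β = 0)
    (hreg : IsRegularTuple (shiftPart T m)) :
    ∃ (g₁ : WithLp 2 (defectStarSpace (nilPart T m) ×
          WithLp 2 (defectSpace T × defectStarSpace T)) →L[ℂ] defectStarSpace T)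
      (g₂ : defectSpace T →L[ℂ] WithLp 2 (defectSpace (nilPart T m) ×
          WithLp 2 (defectSpace T × defectStarSpace T))),
      IsCoisometry g₁ ∧ (∀ x, ‖g₂ x‖ = ‖x‖) ∧
      ∀ z : EuclideanSpace ℂ (Fin n), ‖z‖ < 1 → ∀ x,
        g₁ (inl _ _ (charFun (nilPart T m) z (g₂ x).fst) + inr _ _ (g₂ x).snd) =
          charFun T z x := by
  have hNS : ∀ i, nilPart T m i = compression (nilSpace T m) (T i) := fun _ => rfl
  have hN : ‖row (nilPart T m)‖ ≤ 1 := norm_row_compression_le (nilSpace T m) hT.contr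
  obtain ⟨R, hR, hRD⟩ := exists_defect_compression T hT.contr (nilSpace T m) hNS
  have hcharFun (z : EuclideanSpace ℂ (Fin n)) (hz : ‖z‖ < 1) (x : defectSpace T) :=
    charFun_apply_eq_nilSpace hT hpoly hreg hz x
  -- From here on `N` enters only as a contractive compression of `T`, through `R` and the reduced
  -- state equation.
  generalize nilPart T m = N at *
  have hfac := exists_coisometry_isometry (X := defectSpace T) (Y := defectSpace N)
    (Z := defectStarSpace T) (U := nilSpace T m) (W := defectStarSpace N)
    ((defectStarSpace T).orthogonalProjectionOnto ∘L defectStar T ∘L (nilSpace T m).subtypeL)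
    ((defectStarSpace T).orthogonalProjectionOnto ∘L row T ∘L (defectSpace T).subtypeL)
    ((defectStarSpace N).orthogonalProjectionOnto ∘L defectStar N)
    ((defectStarSpace N).orthogonalProjectionOnto ∘L row N ∘L (defectSpace N).subtypeL) hR
    fun u x => by
      have hmem : defectStar N u - row N (R x) ∈ defectStarSpace N :=
        sub_mem (defectStar_mem N u) (row_mem_defectStarSpace hN (R x).2)
      have e1 : ‖(defectStarSpace N).orthogonalProjectionOnto (defectStar N u - row N (R x))‖ =
          ‖defectStar N u - row N (R x)‖ :=
        congrArg norm (Submodule.starProjection_eq_self_iff.2 hmem)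
      have e2 := norm_sq_output_le hT.contr hNS u (hRD x)
      have e3 : ‖(defectStarSpace T).orthogonalProjectionOnto (defectStar T u - row T x)‖ ≤
          ‖defectStar T u - row T x‖ := Submodule.norm_orthogonalProjectionOnto_apply_le _ _
      have e4 := (pow_le_pow_left₀ (norm_nonneg _) e3 2).trans e2
      rw [← e1, map_sub, map_sub] at e4
      exact e4
  obtain ⟨g₁, hfac⟩ := hfac
  obtain ⟨g₂, hfac⟩ := hfac
  obtain ⟨hg₁, hfac⟩ := hfac
  obtain ⟨hg₂, hg⟩ := hfac
  refine ⟨g₁, g₂, hg₁, hg₂, fun z hz x => ?_⟩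
  obtain ⟨h, hh, hTx⟩ := hcharFun z hz x
  rw [← hRD] at hh
  have hNx := charFun_apply hN hz (R x) hh
  rw [map_sub] at hTx hNx
  exact (hg (charFun N z) h x hNx).trans hTx.symm

end Factorization

end CommutingRow

end

theorem mainTheorem6 {n : ℕ} {H : Type u} [NormedAddCommGroup H] [InnerProductSpace ℂ H]
    [CompleteSpace H] (T : Fin n → H →L[ℂ] H) (m : ℕ)
    (hT : IsCommutingRowContraction T)
    (hpoly : CharFunIsPolynomialOfDegree T m)
    (hreg : IsRegularTuple (shiftPart T m)) :
    ∃ (ΘT : DruryArveson n (defectSpace T) →L[ℂ] DruryArveson n (defectStarSpace T))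
      (ΘN : DruryArveson n (defectSpace (nilPart T m)) →L[ℂ]
        DruryArveson n (defectStarSpace (nilPart T m))),
      IsMultiplicationBy (charFun T) ΘT ∧
      IsMultiplicationBy (charFun (nilPart T m)) ΘN ∧
      ∃ (E : Type u) (_ : NormedAddCommGroup E) (_ : InnerProductSpace ℂ E)
        (_ : CompleteSpace E)
        (G₁ : DruryArveson n (WithLp 2 (defectStarSpace (nilPart T m) × E)) →L[ℂ]
          DruryArveson n (defectStarSpace T))
        (G₂ : DruryArveson n (defectSpace T) →L[ℂ]
          DruryArveson n (WithLp 2 (defectSpace (nilPart T m) × E))),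
        IsCoisometry G₁ ∧ IsPartialIsometry G₂ ∧
        (∃ g₁, G₁ = ampl n g₁) ∧ (∃ g₂, G₂ = ampl n g₂) ∧
        ΘT = G₁ ∘L diagId E ΘN ∘L G₂ := by
  obtain ⟨ΘN, hΘN⟩ := exists_isMultiplicationBy_charFun (nilPart T m) m
    (row_smul_comp_adjoint_row_nilPart_pow hT.comm)
  obtain ⟨g₁, hfac⟩ := exists_charFun_factorization hT hpoly.1 hreg
  obtain ⟨g₂, hfac⟩ := hfac
  obtain ⟨hg₁, hfac⟩ := hfac
  obtain ⟨hg₂, hg⟩ := hfac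
  -- The multiplier `θ_T` is taken to be the product, and the pointwise factorization identifies its
  -- symbol. In `E = 𝓓_T ⊕ 𝓓_{T*}` the first summand holds `D_R x`, the second the defect of `Γ*`.
  exact ⟨ampl n g₁ ∘L diagId (WithLp 2 (defectSpace T × defectStarSpace T)) ΘN ∘L ampl n g₂, ΘN,
    isMultiplicationBy_ampl_comp_diagId hΘN hg, hΘN, WithLp 2 (defectSpace T × defectStarSpace T),
    inferInstance, inferInstance, inferInstance, ampl n g₁, ampl n g₂, hg₁.ampl,
    isPartialIsometry_ampl hg₂, ⟨g₁, rfl⟩, ⟨g₂, rfl⟩, rfl⟩
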